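/- Let $\mathcal U,\mathcal Y$ be complex Hilbert spaces, let $\mathbb B^d$ be the open unit ball of $\mathbb C^d$, and let $\mathcal H_{\mathcal Y}(k_d)$ be the Drury–Arveson space of $\mathcal Y$-valued functions on $\mathbb B^d$, i.e. the reproducing kernel Hilbert space with kernel $k_d(\lambda,\zeta)I_{\mathcal Y}$, $k_d(\lambda,\zeta)=\frac1{1-\langle\lambda,\zeta\rangle}$, $\langle\lambda,\zeta\rangle=\sum_j\lambda_j\overline{\zeta_j}$. Let $S$ belong to the Schur class $\mathcal S_d(\mathcal U,\mathcal Y)$: $S$ is an analytic $\mathcal L(\mathcal U,\mathcal Y)$-valued function on $\mathbb B^d$ such that $M_S:f\mapsto Sf$ is a contraction from $\mathcal H_{\mathcal U}(k_d)$ into $\mathcal H_{\mathcal Y}(k_d)$. Let $\mathcal H(K_S)$ be the de Branges–Rovnyak space, i.e. the reproducing kernel Hilbert space of the positive kernel $K_S(\lambda,\zeta)=\frac{I_{\mathcal Y}-S(\lambda)S(\zeta)^*}{1-\langle\lambda,\zeta\rangle}$, and let $M_{\lambda_j}^*$ be the adjoint, in $\mathcal H_{\mathcal Y}(k_d)$,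 of the operator $M_{\lambda_j}$ of multiplication by the coordinate $\lambda_j$. A *realization* of $S$ is a Hilbert space $\mathcal X$ with a bounded operator $$\mathbf U=\begin{bmatrix}A_1&B_1\\ \vdots&\vdots\\ A_d&B_d\\ C&D\end{bmatrix}:\mathcal X\oplus\mathcal U\to\mathcal X^d\oplus\mathcal Y$$ such that, for all $\lambda\in\mathbb B^d$, $I-Z(\lambda)A$ is invertible and $S(\lambda)=D+C(I-Z(\lambda)A)^{-1}Z(\lambda)B$, where $Z(\lambda)=[\lambda_1I_{\mathcal X}\ \cdots\ \lambda_dI_{\mathcal X}]$ and $A$, $B$ are the columns of the $A_j$, $B_j$. It is *commutative* if $A_iA_j=A_jA_i$ for all $i,j$, and *weakly coisometric* if $\mathbf U^*$ is contractive and is isometric on $\mathcal D\oplus\mathcal Y$, where $$\mathcal D=\overline{\operatorname{span}}\{Z(\zeta)^*(I-A^*Z(\zeta)^*)^{-1}C^*y:\ \zeta\in\mathbb B^d,\ y\in\mathcal Y\}\subset\mathcal X^d .$$ Then $S$ admits a commutative weakly coisometric realization if and only if 1. $\mathcal H(K_S)$ is invariant under $M_{\lambda_j}^*$ for $j=1,\dots,d$,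 and 2. $\sum_{j=1}^d\|M_{\lambda_j}^*f\|^2_{\mathcal H(K_S)}\le\|f\|^2_{\mathcal H(K_S)}-\|f(0)\|^2_{\mathcal Y}$ for all $f\in\mathcal H(K_S)$. In that case there is a functional-model realization: there are bounded operators $B_1,\dots,B_d:\mathcal U\to\mathcal H(K_S)$ which, together with $\mathcal X=\mathcal H(K_S)$, $A_j=M_{\lambda_j}^*|_{\mathcal H(K_S)}$, $Cf=f(0)$ and $D=S(0)$, form a commutative weakly coisometric realization of $S$. -/

import Mathlib

noncomputable section

namespace DruryArveson

open Filter Topology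
open scoped InnerProductSpace ComplexConjugate ComplexOrder

/-! ### The unit ball and the Drury-Arveson space -/

/-- The open unit ball of `ℂ^d`. -/
abbrev Ball (d : ℕ) : Type := Metric.ball (0 : EuclideanSpace ℂ (Fin d)) 1

/-- The centre of the ball. -/
def origin (d : ℕ) : Ball d := ⟨0, Metric.mem_ball_self one_pos⟩

/-- The scalar kernel `k_d(z, w) = 1 / (1 - ⟨z, w⟩)`, where `⟨z, w⟩ = ∑ j, z j * conj (w j)`.
(Mathlib's inner product is conjugate-linear in the first variable.) -/
def arvesonKernel {d : ℕ} (z w : Ball d) : ℂ := (1 - ⟪w.1, z.1⟫_ℂ)⁻¹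

/-- The operator-valued kernel `k_d(z, w) I_Y`. -/
def arvesonKernelOp (d : ℕ) (Y : Type*) [NormedAddCommGroup Y] [InnerProductSpace ℂ Y] :
    Matrix (Ball d) (Ball d) (Y →L[ℂ] Y) :=
  Matrix.of fun z w => arvesonKernel z w • ContinuousLinearMap.id ℂ Y

section

variable {d : ℕ} {Y : Type*} [NormedAddCommGroup Y] [InnerProductSpace ℂ Y]

lemma posSemidef_of_sum_nonneg {K : Matrix (Ball d) (Ball d) (Y →L[ℂ] Y)} [CompleteSpace Y]
    (h1 : ∀ z w, star (K w z) = K z w)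
    (h2 : ∀ vv : Ball d →₀ Y,
      0 ≤ (∑ x ∈ vv.support, ∑ x' ∈ vv.support, ⟪K x' x (vv x), vv x'⟫_ℂ).re) :
    K.PosSemidef := by
  have h := (RKHS.posSemidef_tfae (K := K)).out 0 2
  exact h.mpr ⟨Matrix.ext fun z w => h1 z w, h2⟩

lemma arvesonKernel_conj (z w : Ball d) : conj (arvesonKernel z w) = arvesonKernel w z := by
  simp [arvesonKernel, inner_conj_symm]

lemma norm_inner_ball_lt (z w : Ball d) : ‖⟪w.1, z.1⟫_ℂ‖ < 1 := by
  have hz : ‖z.1‖ < 1 := by have := z.2; rwa [mem_ball_zero_iff] at this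
  have hw : ‖w.1‖ < 1 := by have := w.2; rwa [mem_ball_zero_iff] at this
  calc ‖⟪w.1, z.1⟫_ℂ‖ ≤ ‖w.1‖ * ‖z.1‖ := norm_inner_le_norm _ _
    _ < 1 := by nlinarith [norm_nonneg z.1, norm_nonneg w.1]

lemma one_sub_inner_ne_zero (z w : Ball d) : 1 - ⟪w.1, z.1⟫_ℂ ≠ 0 := by
  intro h
  have h1 : ⟪w.1, z.1⟫_ℂ = 1 := (sub_eq_zero.mp h).symm
  have := norm_inner_ball_lt z w
  rw [h1] at this
  simp at this

/-- The sesquilinear sum in one step of the recursion for powers of the inner product. -/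
lemma sum_inner_smul (s : Finset (Ball d)) (v : Ball d → Y) (c : Ball d → Ball d → ℂ) :
    ∑ x ∈ s, ∑ x' ∈ s, ⟪x'.1, x.1⟫_ℂ * c x x' * ⟪v x, v x'⟫_ℂ =
      ∑ i : Fin d, ∑ x ∈ s, ∑ x' ∈ s,
        c x x' * ⟪conj (x.1 i) • v x, conj (x'.1 i) • v x'⟫_ℂ := by
  rw [Finset.sum_comm]
  conv_rhs => rw [Finset.sum_comm]; enter [2, x]; rw [Finset.sum_comm]
  rw [Finset.sum_comm]
  refine Finset.sum_congr rfl fun x _ => Finset.sum_congr rfl fun x' _ => ?_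
  rw [PiLp.inner_apply, Finset.sum_mul, Finset.sum_mul]
  refine Finset.sum_congr rfl fun i _ => ?_
  simp only [inner_smul_left, inner_smul_right, RCLike.inner_apply, RCLike.conj_conj]
  ring

lemma pow_kernel_nonneg (s : Finset (Ball d)) (n : ℕ) : ∀ v : Ball d → Y,
    0 ≤ (∑ x ∈ s, ∑ x' ∈ s, ⟪x'.1, x.1⟫_ℂ ^ n * ⟪v x, v x'⟫_ℂ).re := by
  induction n with
  | zero =>
    intro v
    simp only [pow_zero, one_mul]
    have : ∑ x ∈ s, ∑ x' ∈ s, ⟪v x, v x'⟫_ℂ = ⟪∑ x ∈ s, v x, ∑ x ∈ s, v x⟫_ℂ := by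
      rw [Finset.sum_comm]
      simp only [sum_inner, inner_sum]
    rw [this]
    exact inner_self_nonneg (𝕜 := ℂ)
  | succ n ih =>
    intro v
    simp only [pow_succ']
    rw [sum_inner_smul s v (fun x x' => ⟪x'.1, x.1⟫_ℂ ^ n), Complex.re_sum]
    exact Finset.sum_nonneg fun i _ => ih (fun x => conj (x.1 i) • v x)

lemma kernel_sum_nonneg (s : Finset (Ball d)) (v : Ball d → Y) :
    0 ≤ (∑ x ∈ s, ∑ x' ∈ s, arvesonKernel x x' * ⟪v x, v x'⟫_ℂ).re := by
  have h : HasSum (fun n : ℕ => ∑ x ∈ s, ∑ x' ∈ s, ⟪x'.1, x.1⟫_ℂ ^ n * ⟪v x, v x'⟫_ℂ)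
      (∑ x ∈ s, ∑ x' ∈ s, arvesonKernel x x' * ⟪v x, v x'⟫_ℂ) :=
    hasSum_sum fun x _ => hasSum_sum fun x' _ =>
      (hasSum_geometric_of_norm_lt_one (norm_inner_ball_lt x x')).mul_right _
  exact (Complex.hasSum_re h).nonneg fun n => pow_kernel_nonneg s n v

variable [CompleteSpace Y]

instance arvesonKernelOp_posSemidef : Fact (arvesonKernelOp d Y).PosSemidef := ⟨by
  refine posSemidef_of_sum_nonneg (fun z w => ?_) fun vv => ?_
  · simp only [arvesonKernelOp, Matrix.of_apply, star_smul, ContinuousLinearMap.star_eq_adjoint,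
      ContinuousLinearMap.adjoint_id]
    rw [← arvesonKernel_conj w z]
    rfl
  · convert kernel_sum_nonneg vv.support vv using 2
    simp only [arvesonKernelOp, Matrix.of_apply, _root_.smul_apply,
      ContinuousLinearMap.id_apply, inner_smul_left, arvesonKernel_conj]⟩

end

/-- The Drury-Arveson space `H_Y(k_d)` of `Y`-valued functions on the ball: the reproducing kernel
Hilbert space of the kernel `k_d(z, w) I_Y`. -/
abbrev Space (d : ℕ) (Y : Type*) [NormedAddCommGroup Y] [InnerProductSpace ℂ Y]
    [CompleteSpace Y] := RKHS.OfKernel (arvesonKernelOp d Y)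

/-! ### Multipliers -/

section

variable {d : ℕ} {U Y : Type*} [NormedAddCommGroup U] [InnerProductSpace ℂ U] [CompleteSpace U]
  [NormedAddCommGroup Y] [InnerProductSpace ℂ Y] [CompleteSpace Y]

/-- Pointwise multiplication by `S` maps `H_U(k_d)` into `H_Y(k_d)`. -/
def MapsSpace (S : Ball d → U →L[ℂ] Y) : Prop :=
  ∀ f : Space d U, ∃ g : Space d Y, ∀ z, g z = S z (f z)

/-- The product `S f` as an element of `H_Y(k_d)`. -/
def mulFun (S : Ball d → U →L[ℂ] Y) (h : MapsSpace S) (f : Space d U) : Space d Y := (h f).choose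

lemma mulFun_apply (S : Ball d → U →L[ℂ] Y) (h : MapsSpace S) (f : Space d U) (z : Ball d) :
    mulFun S h f z = S z (f z) := (h f).choose_spec z

/-- The multiplication operator `M_S : f ↦ S f` as a bounded operator `H_U(k_d) → H_Y(k_d)`
(bounded by the closed graph theorem). -/
def mulOp (S : Ball d → U →L[ℂ] Y) (h : MapsSpace S) : Space d U →L[ℂ] Space d Y :=
  ContinuousLinearMap.ofSeqClosedGraph
    (g := { toFun := mulFun S h
            map_add' := fun f g => RKHS.ext fun z => by simp [mulFun_apply]
            map_smul' := fun c f => RKHS.ext fun z => by simp [mulFun_apply] })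
    (by
      intro u x y hu hy
      refine RKHS.ext fun z => ?_
      have h1 := ((RKHS.continuous_eval (H := Space d Y) z).tendsto y).comp hy
      have h2 := (((S z).continuous.comp (RKHS.continuous_eval (H := Space d U) z)).tendsto x).comp
        hu
      refine (tendsto_nhds_unique h1 (h2.congr fun n => ?_)).trans ?_
      · simp [mulFun_apply]
      · simp [mulFun_apply])

@[simp]
lemma mulOp_apply (S : Ball d → U →L[ℂ] Y) (h : MapsSpace S) (f : Space d U) (z : Ball d) :
    mulOp S h f z = S z (f z) :=
  mulFun_apply S h f z

/-! ### The Schur class and de Branges-Rovnyak spaces -/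

variable (d U Y) in
/-- The Schur class `S_d(U, Y)`: analytic `L(U, Y)`-valued functions on the ball whose
multiplication operator is a contraction `H_U(k_d) → H_Y(k_d)`. -/
def SchurClass : Set (Ball d → U →L[ℂ] Y) :=
  {S | AnalyticOnNhd ℂ (Function.extend Subtype.val S 0)
      (Metric.ball (0 : EuclideanSpace ℂ (Fin d)) 1) ∧
    ∃ h : MapsSpace S, ‖mulOp S h‖ ≤ 1}

/-- The de Branges-Rovnyak kernel `K_S(z, w) = (I - S(z) S(w)^*) / (1 - ⟨z, w⟩)`. -/
def dbrKernel (S : Ball d → U →L[ℂ] Y) : Matrix (Ball d) (Ball d) (Y →L[ℂ] Y) :=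
  Matrix.of fun z w =>
    arvesonKernel z w • (ContinuousLinearMap.id ℂ Y - S z ∘L ContinuousLinearMap.adjoint (S w))

lemma kerFun_inner_kerFun (z w : Ball d) (u v : Y) :
    ⟪RKHS.kerFun (Space d Y) w u, RKHS.kerFun (Space d Y) z v⟫_ℂ = arvesonKernel w z * ⟪u, v⟫_ℂ := by
  rw [← RKHS.kernel_inner, RKHS.OfKernel.kernel_ofKernel]
  simp [arvesonKernelOp, inner_smul_left, arvesonKernel_conj]

lemma adjoint_mulOp_kerFun (S : Ball d → U →L[ℂ] Y) (h : MapsSpace S) (z : Ball d) (y : Y) :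
    ContinuousLinearMap.adjoint (mulOp S h) (RKHS.kerFun (Space d Y) z y) =
      RKHS.kerFun (Space d U) z (ContinuousLinearMap.adjoint (S z) y) := by
  refine ext_inner_right ℂ fun f => ?_
  rw [ContinuousLinearMap.adjoint_inner_left, RKHS.kerFun_inner, RKHS.kerFun_inner,
    ContinuousLinearMap.adjoint_inner_left, mulOp_apply]

lemma posSemidef_dbrKernel (S : Ball d → U →L[ℂ] Y) (h : MapsSpace S) (hS : ‖mulOp S h‖ ≤ 1) :
    (dbrKernel S).PosSemidef := by
  refine posSemidef_of_sum_nonneg (fun z w => ?_) fun vv => ?_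
  · simp only [dbrKernel, Matrix.of_apply, star_smul, ContinuousLinearMap.star_eq_adjoint,
      map_sub, ContinuousLinearMap.adjoint_id, ContinuousLinearMap.adjoint_comp,
      ContinuousLinearMap.adjoint_adjoint]
    rw [← arvesonKernel_conj w z]
    rfl
  · let g : Space d Y := ∑ x ∈ vv.support, RKHS.kerFun (Space d Y) x (vv x)
    have h1 : ∑ x ∈ vv.support, ∑ x' ∈ vv.support, ⟪dbrKernel S x' x (vv x), vv x'⟫_ℂ =
        ⟪g, g⟫_ℂ - ⟪ContinuousLinearMap.adjoint (mulOp S h) g,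
          ContinuousLinearMap.adjoint (mulOp S h) g⟫_ℂ := by
      rw [Finset.sum_comm]
      simp only [g, map_sum, adjoint_mulOp_kerFun, sum_inner, inner_sum, kerFun_inner_kerFun,
        ← Finset.sum_sub_distrib, dbrKernel, Matrix.of_apply,
        _root_.smul_apply, inner_smul_left, arvesonKernel_conj,
        _root_.sub_apply, ContinuousLinearMap.id_apply,
        ContinuousLinearMap.comp_apply, inner_sub_left, mul_sub,
        ContinuousLinearMap.adjoint_inner_right]
    have h2 : ‖ContinuousLinearMap.adjoint (mulOp S h) g‖ ≤ ‖g‖ := by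
      refine (ContinuousLinearMap.le_of_opNorm_le _ ?_ g).trans (one_mul _).le
      rwa [LinearIsometryEquiv.norm_map]
    have h3 := inner_self_eq_norm_sq (𝕜 := ℂ) g
    have h4 := inner_self_eq_norm_sq (𝕜 := ℂ) (ContinuousLinearMap.adjoint (mulOp S h) g)
    rw [RCLike.re_eq_complex_re] at h3 h4
    rw [h1, Complex.sub_re, h3, h4]
    have := norm_nonneg (ContinuousLinearMap.adjoint (mulOp S h) g)
    nlinarith

/-- The de Branges-Rovnyak kernel of a Schur-class function is positive. -/
instance dbrKernel_posSemidef (S : SchurClass d U Y) : Fact (dbrKernel S.1).PosSemidef :=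
  ⟨posSemidef_dbrKernel S.1 S.2.2.choose S.2.2.choose_spec⟩

/-- The de Branges-Rovnyak space `H(K_S)`. -/
abbrev DBRSpace (S : SchurClass d U Y) := RKHS.OfKernel (dbrKernel S.1)

end

/-! ### The backward shifts -/

section

variable {d : ℕ} {Y : Type*} [NormedAddCommGroup Y] [InnerProductSpace ℂ Y] [CompleteSpace Y]

/-- The `j`-th coordinate function `z ↦ z_j I_Y`. -/
def coord (Y : Type*) [NormedAddCommGroup Y] [InnerProductSpace ℂ Y] (j : Fin d) :
    Ball d → Y →L[ℂ] Y :=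
  fun z => z.1 j • ContinuousLinearMap.id ℂ Y

/-- Finite sums of kernel functions of the Drury-Arveson space. -/
def kerSum (d : ℕ) (Y : Type*) [NormedAddCommGroup Y] [InnerProductSpace ℂ Y] [CompleteSpace Y] :
    (Ball d →₀ Y) →ₗ[ℂ] Space d Y :=
  Finsupp.lsum ℂ fun z => (RKHS.kerFun (Space d Y) z).toLinearMap

/-- Finite sums of kernel functions, each multiplied by the conjugate coordinate. -/
def kerSumCoord (Y : Type*) [NormedAddCommGroup Y] [InnerProductSpace ℂ Y] [CompleteSpace Y]
    (j : Fin d) : (Ball d →₀ Y) →ₗ[ℂ] Space d Y :=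
  Finsupp.lsum ℂ fun z => (conj (z.1 j) • RKHS.kerFun (Space d Y) z).toLinearMap

lemma kerSum_denseRange : DenseRange (kerSum d Y) := by
  have h : ((LinearMap.range (kerSum d Y)).topologicalClosure) = ⊤ := by
    rw [eq_top_iff, ← RKHS.kerFun_dense (Space d Y)]
    refine Submodule.topologicalClosure_mono (Submodule.span_le.mpr ?_)
    rintro _ ⟨z, y, rfl⟩
    exact ⟨Finsupp.single z y, by simp [kerSum]⟩
  have := Submodule.dense_iff_topologicalClosure_eq_top.mpr h
  rwa [LinearMap.coe_range] at this

lemma norm_kerSumCoord_le (j : Fin d) (v : Ball d →₀ Y) :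
    ‖kerSumCoord Y j v‖ ≤ 1 * ‖kerSum d Y v‖ := by
  have e1 : ⟪kerSum d Y v, kerSum d Y v⟫_ℂ =
      ∑ x ∈ v.support, ∑ x' ∈ v.support, arvesonKernel x x' * ⟪v x, v x'⟫_ℂ := by
    rw [Finset.sum_comm]
    simp [kerSum, Finsupp.sum, -inner_self_eq_norm_sq_to_K, sum_inner, inner_sum,
      kerFun_inner_kerFun, -RKHS.kerFun_inner, -RKHS.inner_kerFun]
  have e2 : ∀ i : Fin d, ⟪kerSumCoord Y i v, kerSumCoord Y i v⟫_ℂ =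
      ∑ x ∈ v.support, ∑ x' ∈ v.support,
        arvesonKernel x x' * ⟪conj (x.1 i) • v x, conj (x'.1 i) • v x'⟫_ℂ := by
    intro i
    rw [Finset.sum_comm]
    simp only [kerSumCoord, Finsupp.lsum_apply, Finsupp.sum, sum_inner, inner_sum,
      ContinuousLinearMap.coe_coe, _root_.smul_apply, ← map_smul,
      kerFun_inner_kerFun]
  have e3 : ⟪kerSum d Y v, kerSum d Y v⟫_ℂ =
      ⟪∑ x ∈ v.support, v x, ∑ x ∈ v.support, v x⟫_ℂ +
        ∑ i : Fin d, ⟪kerSumCoord Y i v, kerSumCoord Y i v⟫_ℂ := by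
    simp only [e1, e2]
    rw [← sum_inner_smul v.support v (fun x x' => arvesonKernel x x')]
    have e0 : ⟪∑ x ∈ v.support, v x, ∑ x ∈ v.support, v x⟫_ℂ =
        ∑ x ∈ v.support, ∑ x' ∈ v.support, ⟪v x, v x'⟫_ℂ := by
      rw [Finset.sum_comm]
      simp only [sum_inner, inner_sum]
    rw [e0]
    simp only [← Finset.sum_add_distrib]
    refine Finset.sum_congr rfl fun x _ => Finset.sum_congr rfl fun x' _ => ?_
    have := one_sub_inner_ne_zero x x'
    simp only [arvesonKernel]
    field_simp
    ring
  have e4 := congrArg (RCLike.re (K := ℂ)) e3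
  rw [map_add, map_sum] at e4
  simp only [inner_self_eq_norm_sq] at e4
  have e5 : ‖kerSumCoord Y j v‖ ^ 2 ≤ ∑ i : Fin d, ‖kerSumCoord Y i v‖ ^ 2 :=
    Finset.single_le_sum (f := fun i => ‖kerSumCoord Y i v‖ ^ 2) (fun i _ => by positivity)
      (Finset.mem_univ j)
  rw [one_mul]
  refine le_of_sq_le_sq ?_ (norm_nonneg _)
  nlinarith [sq_nonneg ‖∑ x ∈ v.support, v x‖]

/-- The coordinate functions are multipliers of the Drury-Arveson space. -/
lemma coord_mapsSpace (Y : Type*) [NormedAddCommGroup Y] [InnerProductSpace ℂ Y]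
    [CompleteSpace Y] (j : Fin d) : MapsSpace (coord Y j) := by
  intro f
  let T := (kerSumCoord Y j).extendOfNorm (kerSum d Y)
  refine ⟨ContinuousLinearMap.adjoint T f, fun z => ext_inner_left ℂ fun y => ?_⟩
  have hT : T (RKHS.kerFun (Space d Y) z y) = conj (z.1 j) • RKHS.kerFun (Space d Y) z y := by
    have := LinearMap.extendOfNorm_eq (f := kerSumCoord Y j) (e := kerSum d Y) kerSum_denseRange
      ⟨1, norm_kerSumCoord_le j⟩ (Finsupp.single z y)
    have e1 : kerSum d Y (Finsupp.single z y) = RKHS.kerFun (Space d Y) z y := by simp [kerSum]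
    rw [e1] at this
    exact this.trans (by simp [kerSumCoord])
  rw [← RKHS.kerFun_inner, ContinuousLinearMap.adjoint_inner_right, hT, inner_smul_left,
    RKHS.kerFun_inner]
  simp [coord, inner_smul_right]

/-- The shift `M_{z_j}` on `H_Y(k_d)`. -/
def shift (Y : Type*) [NormedAddCommGroup Y] [InnerProductSpace ℂ Y] [CompleteSpace Y]
    (j : Fin d) : Space d Y →L[ℂ] Space d Y :=
  mulOp (coord Y j) (coord_mapsSpace Y j)

/-- For members `f`, `h` of a Hilbert space `H` of `Y`-valued functions on the ball:
`f` belongs to `H_Y(k_d)` and `M_{z_j}^* f = h`, the adjoint being taken in `H_Y(k_d)`. -/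
def BackwardShiftEq {H : Type*} [NormedAddCommGroup H] [InnerProductSpace ℂ H]
    [RKHS ℂ H (Ball d) Y] (j : Fin d) (f h : H) : Prop :=
  ∃ g : Space d Y, (g : Ball d → Y) = f ∧
    (ContinuousLinearMap.adjoint (shift Y j) g : Ball d → Y) = h

/-- `H` is invariant under all the backward shifts `M_{z_j}^*` of `H_Y(k_d)`. -/
def BackwardShiftInvariant (H : Type*) [NormedAddCommGroup H] [InnerProductSpace ℂ H]
    [RKHS ℂ H (Ball d) Y] : Prop :=
  ∀ (j : Fin d) (f : H), ∃ h : H, BackwardShiftEq j f h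

/-- The difference-quotient inequality
`∑ j, ‖M_{z_j}^* f‖^2 ≤ ‖f‖^2 - ‖f 0‖^2` on a backward-shift-invariant space `H`, with the norms of
`f` and of `M_{z_j}^* f` taken in `H`. -/
def DifferenceQuotientInequality (H : Type*) [NormedAddCommGroup H] [InnerProductSpace ℂ H]
    [RKHS ℂ H (Ball d) Y] : Prop :=
  ∀ (f : H) (h : Fin d → H), (∀ j, BackwardShiftEq j f (h j)) →
    ∑ j, ‖h j‖ ^ 2 ≤ ‖f‖ ^ 2 - ‖f (origin d)‖ ^ 2

end

/-! ### Colligations and realizations -/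

/-- A colligation `[A B; C D] : X ⊕ U → X^d ⊕ Y`, given by its blocks. -/
structure Colligation (d : ℕ) (X U Y : Type*)
    [NormedAddCommGroup X] [InnerProductSpace ℂ X]
    [NormedAddCommGroup U] [InnerProductSpace ℂ U]
    [NormedAddCommGroup Y] [InnerProductSpace ℂ Y] where
  /-- the state operators -/
  A : Fin d → X →L[ℂ] X
  /-- the input operators -/
  B : Fin d → U →L[ℂ] X
  /-- the output operator -/
  C : X →L[ℂ] Y
  /-- the feedthrough operator -/
  D : U →L[ℂ] Y

namespace Colligation

variable {d : ℕ} {X U Y : Type*}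
  [NormedAddCommGroup X] [InnerProductSpace ℂ X]
  [NormedAddCommGroup U] [InnerProductSpace ℂ U]
  [NormedAddCommGroup Y] [InnerProductSpace ℂ Y]

/-- The column of a tuple of operators, as an operator into the Hilbert space direct sum `X^d`. -/
def column {V : Type*} [NormedAddCommGroup V] [InnerProductSpace ℂ V]
    (T : Fin d → V →L[ℂ] X) : V →L[ℂ] PiLp 2 (fun _ : Fin d => X) :=
  (PiLp.continuousLinearEquiv 2 ℂ (fun _ : Fin d => X)).symm.toContinuousLinearMap ∘L
    ContinuousLinearMap.pi T

variable (X) in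
/-- The row operator `Z(z) = [z_1 I ... z_d I] : X^d → X`. -/
def row (z : Ball d) : PiLp 2 (fun _ : Fin d => X) →L[ℂ] X :=
  ∑ j, z.1 j • PiLp.proj 2 (fun _ : Fin d => X) j

/-- The connecting operator `[A B; C D] : X ⊕ U → X^d ⊕ Y` between Hilbert space direct sums. -/
def connecting (Γ : Colligation d X U Y) :
    WithLp 2 (X × U) →L[ℂ] WithLp 2 (PiLp 2 (fun _ : Fin d => X) × Y) :=
  (WithLp.prodContinuousLinearEquiv 2 ℂ (PiLp 2 (fun _ : Fin d => X)) Y).symm.toContinuousLinearMap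
    ∘L ((column Γ.A).coprod (column Γ.B)).prod (Γ.C.coprod Γ.D)
    ∘L (WithLp.prodContinuousLinearEquiv 2 ℂ X U).toContinuousLinearMap

/-- `Γ` realizes `S`: `S(z) = D + C (I - Z(z) A)⁻¹ Z(z) B` for every `z` in the ball (the operator
`I - Z(z) A` being boundedly invertible). -/
def Realizes (Γ : Colligation d X U Y) (S : Ball d → U →L[ℂ] Y) : Prop :=
  ∀ z : Ball d, IsUnit (1 - row X z ∘L column Γ.A) ∧
    S z = Γ.D + Γ.C ∘L Ring.inverse (1 - row X z ∘L column Γ.A) ∘L row X z ∘L column Γ.B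

/-- The state operators commute pairwise. -/
def IsCommutative (Γ : Colligation d X U Y) : Prop :=
  ∀ i j, Γ.A i ∘L Γ.A j = Γ.A j ∘L Γ.A i

variable [CompleteSpace X] [CompleteSpace U] [CompleteSpace Y]

/-- The closed linear span of the vectors `Z(w)^* (I - A^* Z(w)^*)⁻¹ C^* y` in `X^d`. -/
def weakDomain (Γ : Colligation d X U Y) : Submodule ℂ (PiLp 2 (fun _ : Fin d => X)) :=
  (Submodule.span ℂ {x | ∃ (w : Ball d) (y : Y),
    x = ContinuousLinearMap.adjoint (row X w)
      (Ring.inverse (1 - ContinuousLinearMap.adjoint (column Γ.A) ∘L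
        ContinuousLinearMap.adjoint (row X w))
        (ContinuousLinearMap.adjoint Γ.C y))}).topologicalClosure

/-- The adjoint of the connecting operator is contractive, and isometric on the subspace
`weakDomain ⊕ Y` of `X^d ⊕ Y`. -/
def IsWeaklyCoisometric (Γ : Colligation d X U Y) : Prop :=
  ‖ContinuousLinearMap.adjoint Γ.connecting‖ ≤ 1 ∧
    ∀ x ∈ Γ.weakDomain, ∀ y : Y,
      ‖ContinuousLinearMap.adjoint Γ.connecting (WithLp.toLp 2 (x, y))‖ = ‖WithLp.toLp 2 (x, y)‖

/-- `Γ` is a commutative weakly coisometric realization of `S`. -/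
structure IsCommWCRealization (Γ : Colligation d X U Y) (S : Ball d → U →L[ℂ] Y) : Prop where
  realizes : Γ.Realizes S
  commutative : Γ.IsCommutative
  weaklyCoisometric : Γ.IsWeaklyCoisometric

end Colligation

/-- `S` admits a commutative weakly coisometric realization whose state space is a Hilbert space in
the universe `Type w`. -/
def HasCommWCRealization.{w, u, v} {d : ℕ}
    {U : Type u} [NormedAddCommGroup U] [InnerProductSpace ℂ U] [CompleteSpace U]
    {Y : Type v} [NormedAddCommGroup Y] [InnerProductSpace ℂ Y] [CompleteSpace Y]
    (S : Ball d → U →L[ℂ] Y) : Prop :=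
  ∃ (X : Type w) (_ : NormedAddCommGroup X) (_ : InnerProductSpace ℂ X) (_ : CompleteSpace X)
    (Γ : Colligation d X U Y), Γ.IsCommWCRealization S

/-- `Γ` is a functional-model realization of `S`: the state space is `H(K_S)`,
`A_j = M_{z_j}^* | H(K_S)`, `C f = f(0)`, `D = S(0)`, and `Γ` is a commutative weakly coisometric
realization of `S`. -/
structure IsFunctionalModel {d : ℕ}
    {U : Type*} [NormedAddCommGroup U] [InnerProductSpace ℂ U] [CompleteSpace U]
    {Y : Type*} [NormedAddCommGroup Y] [InnerProductSpace ℂ Y] [CompleteSpace Y]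
    (S : SchurClass d U Y) (Γ : Colligation d (DBRSpace S) U Y) : Prop where
  state : ∀ (j : Fin d) (f : DBRSpace S), BackwardShiftEq j f (Γ.A j f)
  output : ∀ f : DBRSpace S, Γ.C f = f (origin d)
  feedthrough : Γ.D = S.1 (origin d)
  realization : Γ.IsCommWCRealization S.1

end DruryArveson

end

universe u v w

noncomputable section

namespace DruryArveson

open Filter Topology
open scoped InnerProductSpace ComplexConjugate ComplexOrder

/-! ### Linear pencils of operators -/

section Resolvent

variable {R : Type*} [NormedRing R] [NormedAlgebra ℂ R] [CompleteSpace R]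

/-! Write `K_w y` and `k_w y` for the kernel functions of `H(K_S)` and of the Drury-Arveson space,
and `F_w y = (I - A^* Z(w)^*)⁻¹ C^* y`. Both directions rest on one fact: in a realization, the
adjoint of the connecting operator sends `Z(w)^* F_w y ⊕ y` to `F_w y ⊕ S(w)^* y`.

Necessity. Isometry on these vectors says exactly that the `F_w y` have the Gram matrix of the `K_w
y` (`inner_resolventVector`), so `K_w y ↦ F_w y` extends to an isometry `V` from `H(K_S)` into the
state space. Let `J` be the inclusion of `H(K_S)` into the Drury-Arveson space. Then `L = V J^*`
sends `k_w y` to `F_w y`, and both are resolvent vectors of commuting tuples, the shifts and the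
`A_j^*`. Differentiation in the ball variable upgrades this to `L M_j = A_j^* L`
(`intertwines_of_intertwines_resolvent`). Taking adjoints and using `V^* V = 1` shows that `M_j^*`
acts on `H(K_S)` as `V^* A_j V`, and contractivity of the colligation gives the inequality.

Sufficiency. The inequality makes the column of the restricted backward shifts and of evaluation at
the origin a contraction. Its adjoint `T` sends `e_w y = Z(w)^* K_w y ⊕ y` to `K_w y`. The
definition of `K_S` says that the Gram matrix of the `e_w y` is that of the `K_w y` plus that of the
`S(w)^* y`. Hence `T` completes to a contraction `(T, R)` with `R e_w y = S(w)^* y`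
(`exists_contractive_completion`), and this is the adjoint of the required connecting operator. -/

lemma hasDerivAt_inverse_one_sub (x b : R) (t : ℂ) (h : IsUnit (1 - (x + t • b))) :
    HasDerivAt (fun s : ℂ => Ring.inverse (1 - (x + s • b)))
      (Ring.inverse (1 - (x + t • b)) * b * Ring.inverse (1 - (x + t • b))) t := by
  obtain ⟨u, hu⟩ := h
  have h1 : HasDerivAt (fun s : ℂ => 1 - (x + s • b)) (-b) t := by
    simpa using! (((hasDerivAt_id t).smul_const b).const_add x).const_sub 1
  have h2 := hasFDerivAt_ringInverse (𝕜 := ℂ) u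
  rw [hu] at h2
  have h3 := h2.comp_hasDerivAt t h1
  rw [← hu, Ring.inverse_unit]
  simpa [Function.comp_def] using! h3

/-- With `r = (1 - t a)⁻¹`, the product rule gives `b r + b (t r a r)`, and `r (t a) r = r² - r`
collapses this to `b r²`. Commutation turns it into `r b r`, the form of a directional derivative of
the resolvent. -/
lemma hasDerivAt_smul_mul_inverse (a b : R) (hab : Commute a b) (t : ℂ)
    (h : IsUnit (1 - t • a)) :
    HasDerivAt (fun s : ℂ => s • (b * Ring.inverse (1 - s • a)))
      (Ring.inverse (1 - t • a) * b * Ring.inverse (1 - t • a)) t := by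
  have h1 := hasDerivAt_inverse_one_sub 0 a t (by simpa using h)
  simp only [zero_add] at h1
  have h2 := (hasDerivAt_id t).smul (h1.const_mul b)
  convert! h2 using 1
  have hc : Commute (1 - t • a) b := (Commute.one_left b).sub_left (hab.smul_left t)
  have hi : Commute (Ring.inverse (1 - t • a)) b := by
    obtain ⟨u, hu⟩ := h
    rw [← hu] at hc ⊢
    rw [Ring.inverse_unit]
    exact hc.units_inv_left
  have hr : Ring.inverse (1 - t • a) * (t • a) * Ring.inverse (1 - t • a) =
      Ring.inverse (1 - t • a) * Ring.inverse (1 - t • a) - Ring.inverse (1 - t • a) := by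
    have h3 : t • a = 1 - (1 - t • a) := by abel
    have h4 := Ring.inverse_mul_cancel _ h
    generalize Ring.inverse (1 - t • a) = r at *
    rw [h3, mul_sub, h4, sub_mul, mul_one, one_mul]
  rw [hi.eq, id, one_smul, ← mul_smul_comm, ← smul_mul_assoc, ← mul_smul_comm, hr, mul_sub,
    mul_assoc, sub_add_cancel]

end Resolvent

section Pencil

variable {d : ℕ} {X H : Type*} [NormedAddCommGroup X] [NormedSpace ℂ X]
  [NormedAddCommGroup H] [NormedSpace ℂ H]

/-- The linear pencil `∑ j, v_j T_j` of a tuple of operators. -/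
def pencil (T : Fin d → X →L[ℂ] X) (v : EuclideanSpace ℂ (Fin d)) : X →L[ℂ] X :=
  ∑ j, v j • T j

lemma pencil_apply (T : Fin d → X →L[ℂ] X) (v : EuclideanSpace ℂ (Fin d)) (x : X) :
    pencil T v x = ∑ j, v j • T j x := by
  simp [pencil]

lemma pencil_smul (T : Fin d → X →L[ℂ] X) (t : ℂ) (v : EuclideanSpace ℂ (Fin d)) :
    pencil T (t • v) = t • pencil T v := by
  simp [pencil, Finset.smul_sum, smul_smul]

lemma pencil_add_single (T : Fin d → X →L[ℂ] X) (v : EuclideanSpace ℂ (Fin d)) (s : ℂ)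
    (j : Fin d) : pencil T (v + s • EuclideanSpace.single j 1) = pencil T v + s • T j := by
  simp [pencil, add_smul, Finset.sum_add_distrib]

lemma commute_pencil (T : Fin d → X →L[ℂ] X) (hT : ∀ i j, T i * T j = T j * T i)
    (v : EuclideanSpace ℂ (Fin d)) (j : Fin d) : Commute (pencil T v) (T j) :=
  Commute.sum_left _ _ _ fun i _ => Commute.smul_left (hT i j) _

lemma norm_pencil_le (T : Fin d → X →L[ℂ] X) (hT : ∀ x, ∑ j, ‖T j x‖ ^ 2 ≤ ‖x‖ ^ 2)
    (v : EuclideanSpace ℂ (Fin d)) : ‖pencil T v‖ ≤ ‖v‖ := by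
  refine ContinuousLinearMap.opNorm_le_bound _ (norm_nonneg _) fun x => ?_
  rw [pencil_apply]
  refine (norm_sum_le _ _).trans ?_
  simp only [norm_smul]
  have h1 := Finset.sum_mul_sq_le_sq_mul_sq Finset.univ (fun j => ‖v j‖) (fun j => ‖T j x‖)
  rw [← EuclideanSpace.norm_sq_eq] at h1
  refine le_of_sq_le_sq (h1.trans ?_) (by positivity)
  rw [mul_pow]
  exact mul_le_mul_of_nonneg_left (hT x) (by positivity)

lemma isUnit_one_sub_pencil [CompleteSpace X] (T : Fin d → X →L[ℂ] X)
    (hT : ∀ x, ∑ j, ‖T j x‖ ^ 2 ≤ ‖x‖ ^ 2) (z : Ball d) : IsUnit (1 - pencil T z.1) :=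
  isUnit_one_sub_of_norm_lt_one ((norm_pencil_le T hT z.1).trans_lt (mem_ball_zero_iff.mp z.2))

/-- An operator that intertwines the resolvent vectors of two commuting tuples on the ball also
intertwines their images under the members of the tuples. -/
theorem intertwines_of_intertwines_resolvent [CompleteSpace X] [CompleteSpace H]
    (M : Fin d → H →L[ℂ] H) (T : Fin d → X →L[ℂ] X)
    (hMc : ∀ i j, M i * M j = M j * M i) (hTc : ∀ i j, T i * T j = T j * T i)
    (hM : ∀ z : Ball d, IsUnit (1 - pencil M z.1)) (hT : ∀ z : Ball d, IsUnit (1 - pencil T z.1))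
    (L : H →L[ℂ] X) (e : H) (c : X)
    (h : ∀ z : Ball d, L (Ring.inverse (1 - pencil M z.1) e) = Ring.inverse (1 - pencil T z.1) c)
    (z : Ball d) (j : Fin d) :
    L (M j (Ring.inverse (1 - pencil M z.1) e)) = T j (Ring.inverse (1 - pencil T z.1) c) := by
  -- The identity is integrated along the complex line through `z`. Its part inside the ball is
  -- convex and contains both 0 and 1.
  set s : Set ℂ := {t | t • z.1 ∈ Metric.ball (0 : EuclideanSpace ℂ (Fin d)) 1} with hs
  have hso : IsOpen s := Metric.isOpen_ball.preimage (by fun_prop)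
  have hsc : IsPreconnected s := by
    have : Convex ℝ s := by
      intro x hx y hy a b ha hb hab
      have := (convex_ball (0 : EuclideanSpace ℂ (Fin d)) 1) hx hy ha hb hab
      simpa only [hs, Set.mem_ofPred_eq, add_smul, smul_assoc] using this
    exact this.isPreconnected
  set Φ : ℂ → X := fun t => L ((t • (M j * Ring.inverse (1 - t • pencil M z.1))) e) -
    (t • (T j * Ring.inverse (1 - t • pencil T z.1))) c with hΦ
  have key : ∀ t ∈ s, HasDerivAt Φ 0 t := by
    intro t ht
    have uM : IsUnit (1 - t • pencil M z.1) := by rw [← pencil_smul]; exact hM ⟨t • z.1, ht⟩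
    have uT : IsUnit (1 - t • pencil T z.1) := by rw [← pencil_smul]; exact hT ⟨t • z.1, ht⟩
    have d1 := hasDerivAt_smul_mul_inverse _ _ (commute_pencil M hMc z.1 j) t uM
    have d2 := hasDerivAt_smul_mul_inverse _ _ (commute_pencil T hTc z.1 j) t uT
    -- These are the derivatives of the resolvents at `t z` in the direction of the `j`-th
    -- coordinate. They coincide with `d1` and `d2`, so differentiating the hypothesis in that
    -- direction makes the derivative of `Φ` vanish.
    have e1 := hasDerivAt_inverse_one_sub (t • pencil M z.1) (M j) 0 (by simpa using uM)
    have e2 := hasDerivAt_inverse_one_sub (t • pencil T z.1) (T j) 0 (by simpa using uT)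
    have d3 := (L.hasFDerivAt.comp_hasDerivAt t (d1.clm_apply (hasDerivAt_const t e))).sub
      (d2.clm_apply (hasDerivAt_const t c))
    have e3 := (L.hasFDerivAt.comp_hasDerivAt (0 : ℂ) (e1.clm_apply (hasDerivAt_const 0 e))).sub
      (e2.clm_apply (hasDerivAt_const 0 c))
    have ev : ∀ᶠ r : ℂ in 𝓝 0, t • z.1 + r • EuclideanSpace.single j 1 ∈
        Metric.ball (0 : EuclideanSpace ℂ (Fin d)) 1 := by
      have hc : ContinuousAt (fun r : ℂ => t • z.1 + r • EuclideanSpace.single j (1 : ℂ)) 0 := by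
        fun_prop
      refine hc.eventually_mem (Metric.isOpen_ball.mem_nhds ?_)
      rw [zero_smul, add_zero]
      exact ht
    have e4 := (hasDerivAt_const (0 : ℂ) (0 : X)).congr_of_eventuallyEq
      (f₁ := fun r : ℂ => L (Ring.inverse (1 - (t • pencil M z.1 + r • M j)) e) -
        Ring.inverse (1 - (t • pencil T z.1 + r • T j)) c) (by
      filter_upwards [ev] with r hr
      have := h ⟨_, hr⟩
      rw [pencil_add_single, pencil_add_single, pencil_smul, pencil_smul] at this
      rw [this, sub_self])
    have e5 := HasDerivAt.unique e3 e4
    have d4 : HasDerivAt Φ _ t := d3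
    refine d4.congr_deriv ?_
    simpa only [zero_smul, add_zero, map_zero] using e5
  have h1 : (1 : ℂ) ∈ s := by simpa only [hs, Set.mem_ofPred_eq, one_smul] using z.2
  have h0 : (0 : ℂ) ∈ s := by simp [hs]
  have := hso.is_const_of_deriv_eq_zero hsc
    (fun t ht => (key t ht).differentiableAt.differentiableWithinAt)
    (fun t ht => (key t ht).deriv) h1 h0
  simpa [hΦ, sub_eq_zero] using this

end Pencil

/-! ### Contractions determined by Gram matrices -/

section Gram

variable {ι Y H K : Type*} [NormedAddCommGroup Y] [InnerProductSpace ℂ Y]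
  [NormedAddCommGroup H] [InnerProductSpace ℂ H] [NormedAddCommGroup K] [InnerProductSpace ℂ K]

lemma norm_lsum_eq_of_inner_eq (a : ι → Y →ₗ[ℂ] H) (b : ι → Y →ₗ[ℂ] K)
    (h : ∀ i j u v, ⟪a i u, a j v⟫_ℂ = ⟪b i u, b j v⟫_ℂ) (v : ι →₀ Y) :
    ‖Finsupp.lsum ℂ b v‖ = ‖Finsupp.lsum ℂ a v‖ := by
  have : ⟪Finsupp.lsum ℂ b v, Finsupp.lsum ℂ b v⟫_ℂ =
      ⟪Finsupp.lsum ℂ a v, Finsupp.lsum ℂ a v⟫_ℂ := by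
    simp only [Finsupp.lsum_apply, Finsupp.sum, sum_inner, inner_sum, h]
  rw [inner_self_eq_norm_sq_to_K, inner_self_eq_norm_sq_to_K] at this
  exact (sq_eq_sq₀ (norm_nonneg _) (norm_nonneg _)).mp (by exact_mod_cast this)

/-- If two families have the same Gram matrix, then a contraction maps the first one to the second;
it is isometric on the closed span of the first family. -/
theorem exists_contraction_of_inner_eq [CompleteSpace H] [CompleteSpace K]
    (a : ι → Y →ₗ[ℂ] H) (b : ι → Y →ₗ[ℂ] K)
    (h : ∀ i j u v, ⟪a i u, a j v⟫_ℂ = ⟪b i u, b j v⟫_ℂ) :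
    ∃ V : H →L[ℂ] K, (∀ i u, V (a i u) = b i u) ∧ (∀ x, ‖V x‖ ≤ ‖x‖) ∧
      ∀ x ∈ (LinearMap.range (Finsupp.lsum ℂ a)).topologicalClosure, ‖V x‖ = ‖x‖ := by
  set e := Finsupp.lsum ℂ a with he
  set E := (LinearMap.range e).topologicalClosure with hE
  have hmem : ∀ v, e v ∈ E := fun v => Submodule.le_topologicalClosure _ ⟨v, rfl⟩
  let e' : (ι →₀ Y) →ₗ[ℂ] E := e.codRestrict E hmem
  have hd : DenseRange e' := by
    rintro ⟨x, hx⟩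
    rw [closure_subtype, ← Set.range_comp]
    exact hx
  have hn : ∀ v, ‖Finsupp.lsum ℂ b v‖ ≤ 1 * ‖e' v‖ := fun v => by
    rw [one_mul, norm_lsum_eq_of_inner_eq a b h v]
    rfl
  have : CompleteSpace E := (Submodule.isClosed_topologicalClosure _).completeSpace_coe
  -- Equality of norms makes the map from the first family to the second well defined and isometric
  -- on a dense subspace of `E`. Composing the extension with the projection onto `E` defines it
  -- everywhere.
  let W : E →L[ℂ] K := (Finsupp.lsum ℂ b).extendOfNorm e'
  have hW : ∀ v, W (e' v) = Finsupp.lsum ℂ b v := fun v =>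
    LinearMap.extendOfNorm_eq hd ⟨1, hn⟩ v
  have hWn : ∀ x, ‖W x‖ ≤ ‖x‖ := fun x => by
    simpa using LinearMap.norm_extendOfNorm_apply_le hd 1 hn x
  have hWi : ∀ x, ‖W x‖ = ‖x‖ := fun x =>
    hd.induction_on (p := fun x => ‖W x‖ = ‖x‖) x (isClosed_eq (by fun_prop) (by fun_prop))
      fun v => by
        rw [hW, norm_lsum_eq_of_inner_eq a b h v]
        rfl
  have hP : ∀ x (hx : x ∈ E), E.orthogonalProjectionOnto x = ⟨x, hx⟩ := fun x hx =>
    Submodule.orthogonalProjectionOnto_mem_subspace_eq_self (K := E) ⟨x, hx⟩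
  refine ⟨W ∘L E.orthogonalProjectionOnto, fun i u => ?_, fun x => ?_, fun x hx => ?_⟩
  · have h1 : e (Finsupp.single i u) = a i u := by simp [he]
    have h2 := hW (Finsupp.single i u)
    rw [ContinuousLinearMap.comp_apply, hP _ (h1 ▸ hmem (Finsupp.single i u))]
    simp only [Finsupp.lsum_single] at h2
    rw [← h2]
    congr 1
    exact Subtype.ext h1.symm
  · exact (hWn _).trans (Submodule.norm_orthogonalProjectionOnto_apply_le E x)
  · rw [ContinuousLinearMap.comp_apply, hP x hx, hWi]
    rfl

/-- A map that preserves the norm on a subspace preserves the inner product there. -/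
lemma inner_map_map_of_norm_eq (T : H →L[ℂ] K) (p : Submodule ℂ H) (h : ∀ x ∈ p, ‖T x‖ = ‖x‖)
    {x y : H} (hx : x ∈ p) (hy : y ∈ p) : ⟪T x, T y⟫_ℂ = ⟪x, y⟫_ℂ :=
  LinearIsometry.inner_map_map
    (⟨T.toLinearMap ∘ₗ p.subtype, fun x => h x x.2⟩ : p →ₗᵢ[ℂ] K) ⟨x, hx⟩ ⟨y, hy⟩

end Gram

/-! ### Kernel functions -/

section Kernel

variable {d : ℕ} {Y : Type*} [NormedAddCommGroup Y] [InnerProductSpace ℂ Y] [CompleteSpace Y]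
  {H : Type*} [NormedAddCommGroup H] [InnerProductSpace ℂ H] [CompleteSpace H]
  [RKHS ℂ H (Ball d) Y]

lemma range_lsum_kerFun_dense :
    (LinearMap.range (Finsupp.lsum ℂ fun z : Ball d =>
      (RKHS.kerFun H z : Y →L[ℂ] H).toLinearMap)).topologicalClosure = ⊤ := by
  rw [eq_top_iff, ← RKHS.kerFun_dense (𝕜 := ℂ) (X := Ball d) (V := Y) H]
  refine Submodule.topologicalClosure_mono (Submodule.span_le.mpr ?_)
  rintro _ ⟨z, y, rfl⟩
  exact ⟨Finsupp.single z y, by simp⟩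

lemma coe_sum_apply {ι : Type*} (s : Finset ι) (F : ι → H) (z : Ball d) :
    (∑ j ∈ s, F j) z = ∑ j ∈ s, F j z := by
  simpa only [RKHS.adjoint_kerFun] using
    map_sum (ContinuousLinearMap.adjoint (RKHS.kerFun H z : Y →L[ℂ] H)) F s

lemma ext_kerFun {E : Type*} [NormedAddCommGroup E] [NormedSpace ℂ E] {f g : H →L[ℂ] E}
    (h : ∀ (z : Ball d) (y : Y), f (RKHS.kerFun H z y) = g (RKHS.kerFun H z y)) : f = g := by
  refine ContinuousLinearMap.ext_on (s := {RKHS.kerFun H x v | (x : Ball d) (v : Y)})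
    (Submodule.dense_iff_topologicalClosure_eq_top.mpr (RKHS.kerFun_dense H)) ?_
  rintro _ ⟨z, y, rfl⟩
  exact h z y

lemma kerFun_apply_space (w z : Ball d) (y : Y) :
    RKHS.kerFun (Space d Y) w y z = arvesonKernel z w • y := by
  rw [RKHS.kerFun_apply, RKHS.OfKernel.kernel_ofKernel]
  simp [arvesonKernelOp]

lemma arvesonKernel_origin (z : Ball d) : arvesonKernel z (origin d) = 1 := by
  simp [arvesonKernel, origin]

lemma inner_mul_arvesonKernel (z w : Ball d) :
    (∑ j, z.1 j * conj (w.1 j)) * arvesonKernel z w = arvesonKernel z w - 1 := by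
  have h1 : ∑ j, z.1 j * conj (w.1 j) = ⟪w.1, z.1⟫_ℂ := by
    simp [PiLp.inner_apply]
  have := one_sub_inner_ne_zero z w
  rw [h1, arvesonKernel]
  field_simp
  ring

lemma shift_apply (j : Fin d) (f : Space d Y) (z : Ball d) : shift Y j f z = z.1 j • f z := by
  simp [shift, coord]

lemma adjoint_shift_kerFun (j : Fin d) (z : Ball d) (y : Y) :
    ContinuousLinearMap.adjoint (shift Y j) (RKHS.kerFun (Space d Y) z y) =
      conj (z.1 j) • RKHS.kerFun (Space d Y) z y := by
  refine ext_inner_right ℂ fun f => ?_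
  rw [ContinuousLinearMap.adjoint_inner_left, inner_smul_left, RKHS.kerFun_inner,
    RKHS.kerFun_inner, shift_apply, inner_smul_right]
  simp

lemma shift_commute (i j : Fin d) : shift Y i * shift Y j = shift Y j * shift Y i := by
  refine ContinuousLinearMap.ext fun f => RKHS.ext fun z => ?_
  simp only [mul_apply_eq_comp, shift_apply, smul_smul, mul_comm]

/-- On kernel functions this is the identity `k = 1 + ⟨z, w⟩ k` for `k = 1 / (1 - ⟨z, w⟩)`; density
gives the rest. -/
lemma sum_shift_adjoint_shift (f : Space d Y) :
    f = RKHS.kerFun (Space d Y) (origin d) (f (origin d)) +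
      ∑ j, shift Y j (ContinuousLinearMap.adjoint (shift Y j) f) := by
  have : ContinuousLinearMap.id ℂ (Space d Y) =
      RKHS.kerFun (Space d Y) (origin d) ∘L
        ContinuousLinearMap.adjoint (RKHS.kerFun (Space d Y) (origin d)) +
      ∑ j, shift Y j ∘L ContinuousLinearMap.adjoint (shift Y j) := by
    refine ext_kerFun fun w y => RKHS.ext fun z => ?_
    have h := inner_mul_arvesonKernel z w
    have h0 : arvesonKernel (origin d) w = 1 := by
      rw [← arvesonKernel_conj, arvesonKernel_origin, map_one]
    simp only [ContinuousLinearMap.id_apply, _root_.add_apply,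
      _root_.sum_apply, ContinuousLinearMap.comp_apply, RKHS.adjoint_kerFun,
      adjoint_shift_kerFun, map_smul, RKHS.coe_add, Pi.add_apply, coe_sum_apply, RKHS.coe_smul,
      Pi.smul_apply, shift_apply, kerFun_apply_space, arvesonKernel_origin, h0, one_smul,
      smul_smul, ← Finset.sum_smul]
    have h2 : ∑ j, conj (w.1 j) * (z.1 j * arvesonKernel z w) = arvesonKernel z w - 1 := by
      rw [← h, Finset.sum_mul]
      exact Finset.sum_congr rfl fun j _ => by ring
    rw [h2, sub_smul, one_smul]
    abel
  simpa using congrArg (fun T : Space d Y →L[ℂ] Space d Y => T f) this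

/-- A function in the Drury-Arveson space is recovered from its backward shifts. -/
lemma apply_eq_add_sum_adjoint_shift (f : Space d Y) (z : Ball d) :
    f z = f (origin d) + ∑ j, z.1 j • ContinuousLinearMap.adjoint (shift Y j) f z := by
  conv_lhs => rw [sum_shift_adjoint_shift f]
  simp only [RKHS.coe_add, Pi.add_apply, coe_sum_apply, shift_apply, kerFun_apply_space,
    arvesonKernel_origin, one_smul]

/-- Pairing the decomposition of `f` with `f` leaves the nonnegative defect `‖f(0)‖²`. -/
lemma sum_norm_sq_adjoint_shift_le (f : Space d Y) :
    ∑ j, ‖ContinuousLinearMap.adjoint (shift Y j) f‖ ^ 2 ≤ ‖f‖ ^ 2 := by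
  have h := congrArg (fun g => RCLike.re ⟪g, f⟫_ℂ) (sum_shift_adjoint_shift f)
  have hj : ∀ j (g : Space d Y), ⟪shift Y j g, f⟫_ℂ =
      ⟪g, ContinuousLinearMap.adjoint (shift Y j) f⟫_ℂ :=
    fun j g => (ContinuousLinearMap.adjoint_inner_right _ _ _).symm
  simp only [inner_add_left, sum_inner, hj, RKHS.kerFun_inner, map_add, map_sum,
    inner_self_eq_norm_sq] at h
  nlinarith [sq_nonneg ‖f (origin d)‖]

end Kernel

/-! ### Conjugation on the ball and adjoints of pencils -/

section Conj

variable {d : ℕ}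

/-- The coordinatewise complex conjugate of a point of the ball. -/
def conjBall (z : Ball d) : Ball d :=
  ⟨WithLp.toLp 2 fun j => conj (z.1 j), by
    have h := mem_ball_zero_iff.mp z.2
    rw [mem_ball_zero_iff]
    rw [EuclideanSpace.norm_eq] at h ⊢
    simpa using h⟩

@[simp]
lemma conjBall_apply (z : Ball d) (j : Fin d) : (conjBall z).1 j = conj (z.1 j) := rfl

@[simp]
lemma conjBall_conjBall (z : Ball d) : conjBall (conjBall z) = z :=
  Subtype.ext (PiLp.ext fun j => by simp)

variable {X : Type*} [NormedAddCommGroup X] [InnerProductSpace ℂ X] [CompleteSpace X]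

lemma adjoint_pencil (A : Fin d → X →L[ℂ] X) (z : Ball d) :
    ContinuousLinearMap.adjoint (pencil A z.1) =
      pencil (fun j => ContinuousLinearMap.adjoint (A j)) (conjBall z).1 := by
  simp only [pencil, map_sum, conjBall_apply, LinearIsometryEquiv.map_smulₛₗ]

lemma star_one_sub_pencil (A : Fin d → X →L[ℂ] X) (z : Ball d) :
    star (1 - pencil A z.1) =
      1 - pencil (fun j => ContinuousLinearMap.adjoint (A j)) (conjBall z).1 := by
  rw [star_sub, star_one, ContinuousLinearMap.star_eq_adjoint, adjoint_pencil]

/-- The column bound holds for the adjoint shifts, in general not for the shifts themselves. So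
invertibility is proved for the adjoint pencil, at the conjugate point, and transported by `star`.
-/
lemma isUnit_one_sub_pencil_shift {Y : Type*} [NormedAddCommGroup Y] [InnerProductSpace ℂ Y]
    [CompleteSpace Y] (z : Ball d) : IsUnit (1 - pencil (shift Y) z.1) := by
  have h := (isUnit_one_sub_pencil (fun j => ContinuousLinearMap.adjoint (shift Y j))
    sum_norm_sq_adjoint_shift_le (conjBall z)).star
  rw [star_one_sub_pencil] at h
  simpa only [ContinuousLinearMap.adjoint_adjoint, conjBall_conjBall] using h

/-- The kernel functions are the resolvent vectors of the tuple of shifts. -/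
lemma inverse_one_sub_pencil_shift {Y : Type*} [NormedAddCommGroup Y] [InnerProductSpace ℂ Y]
    [CompleteSpace Y] (w : Ball d) (y : Y) :
    Ring.inverse (1 - pencil (shift Y) (conjBall w).1) (RKHS.kerFun (Space d Y) (origin d) y) =
      RKHS.kerFun (Space d Y) w y := by
  have h : (1 - pencil (shift Y) (conjBall w).1) (RKHS.kerFun (Space d Y) w y) =
      RKHS.kerFun (Space d Y) (origin d) y := by
    refine RKHS.ext fun z => ?_
    have h := inner_mul_arvesonKernel z w
    simp only [_root_.sub_apply, one_apply_eq_self, pencil_apply, RKHS.coe_sub,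
      Pi.sub_apply, coe_sum_apply, RKHS.coe_smul, Pi.smul_apply, shift_apply, kerFun_apply_space,
      arvesonKernel_origin, smul_smul, ← Finset.sum_smul, ← sub_smul, conjBall_apply]
    congr 1
    rw [sub_eq_iff_eq_add, ← sub_eq_iff_eq_add', ← h, Finset.sum_mul]
    exact Finset.sum_congr rfl fun j _ => by ring
  rw [← h, ← mul_apply_eq_comp,
    Ring.inverse_mul_cancel _ (isUnit_one_sub_pencil_shift _), one_apply_eq_self]

end Conj

/-! ### The inclusion of the de Branges-Rovnyak space -/

section Inclusion

variable {d : ℕ} {U Y : Type*} [NormedAddCommGroup U] [InnerProductSpace ℂ U] [CompleteSpace U]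
  [NormedAddCommGroup Y] [InnerProductSpace ℂ Y] [CompleteSpace Y]

lemma inner_kerFun_dbr (S : SchurClass d U Y) (z w : Ball d) (u v : Y) :
    ⟪RKHS.kerFun (DBRSpace S) w u, RKHS.kerFun (DBRSpace S) z v⟫_ℂ = arvesonKernel w z *
      (⟪u, v⟫_ℂ - ⟪ContinuousLinearMap.adjoint (S.1 w) u,
        ContinuousLinearMap.adjoint (S.1 z) v⟫_ℂ) := by
  rw [← RKHS.kernel_inner, RKHS.OfKernel.kernel_ofKernel]
  simp [dbrKernel, inner_smul_left, arvesonKernel_conj, inner_sub_left,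
    ContinuousLinearMap.adjoint_inner_right]

/-- The de Branges-Rovnyak space is contained in the Drury-Arveson space. -/
lemma exists_dbrInclusion (S : SchurClass d U Y) :
    ∃ J : DBRSpace S →L[ℂ] Space d Y, ∀ f z, J f z = f z := by
  -- Since `k_d(z, w) I = K_S(z, w) + k_d(z, w) S(z) S(w)^*`, the map `k_w y ↦ K_w y ⊕ k_w S(w)^* y`
  -- preserves Gram matrices. The inclusion is the adjoint of its first component.
  let b : Ball d → Y →ₗ[ℂ] WithLp 2 (DBRSpace S × Space d U) := fun w =>
    ((WithLp.prodContinuousLinearEquiv 2 ℂ (DBRSpace S) (Space d U)).symm.toContinuousLinearMap ∘L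
      (RKHS.kerFun (DBRSpace S) w).prod
        (RKHS.kerFun (Space d U) w ∘L ContinuousLinearMap.adjoint (S.1 w))).toLinearMap
  obtain ⟨V, hV, -, -⟩ := exists_contraction_of_inner_eq
    (fun w => (RKHS.kerFun (Space d Y) w).toLinearMap) b (by
      intro w z u v
      simp only [b, ContinuousLinearMap.coe_coe, kerFun_inner_kerFun, WithLp.prod_inner_apply,
        ContinuousLinearMap.comp_apply]
      simp only [ContinuousLinearEquiv.coe_coe, WithLp.prodContinuousLinearEquiv_symm_apply,
        ContinuousLinearMap.prod_apply, ContinuousLinearMap.comp_apply, inner_kerFun_dbr,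
        kerFun_inner_kerFun]
      ring)
  let F : WithLp 2 (DBRSpace S × Space d U) →L[ℂ] DBRSpace S :=
    ContinuousLinearMap.fst ℂ _ _ ∘L
      (WithLp.prodContinuousLinearEquiv 2 ℂ (DBRSpace S) (Space d U)).toContinuousLinearMap
  refine ⟨ContinuousLinearMap.adjoint (F ∘L V), fun f z => ext_inner_left ℂ fun y => ?_⟩
  have h : V (RKHS.kerFun (Space d Y) z y) = b z y := hV z y
  rw [← RKHS.kerFun_inner, ContinuousLinearMap.adjoint_inner_right,
    ContinuousLinearMap.comp_apply, h, ← RKHS.kerFun_inner]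
  rfl

/-- The inclusion of `H(K_S)` into `H_Y(k_d)`. -/
def dbrInclusion (S : SchurClass d U Y) : DBRSpace S →L[ℂ] Space d Y :=
  (exists_dbrInclusion S).choose

lemma dbrInclusion_apply (S : SchurClass d U Y) (f : DBRSpace S) (z : Ball d) :
    dbrInclusion S f z = f z :=
  (exists_dbrInclusion S).choose_spec f z

lemma adjoint_dbrInclusion_kerFun (S : SchurClass d U Y) (z : Ball d) (y : Y) :
    ContinuousLinearMap.adjoint (dbrInclusion S) (RKHS.kerFun (Space d Y) z y) =
      RKHS.kerFun (DBRSpace S) z y := by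
  refine ext_inner_right ℂ fun f => ?_
  rw [ContinuousLinearMap.adjoint_inner_left, RKHS.kerFun_inner, RKHS.kerFun_inner,
    dbrInclusion_apply]

lemma backwardShiftEq_iff (S : SchurClass d U Y) (j : Fin d) (f h : DBRSpace S) :
    BackwardShiftEq j f h ↔
      ContinuousLinearMap.adjoint (shift Y j) (dbrInclusion S f) = dbrInclusion S h := by
  constructor
  · rintro ⟨g, hg, hh⟩
    have h1 : dbrInclusion S f = g :=
      RKHS.ext fun z => (dbrInclusion_apply S f z).trans (congrFun hg z).symm
    refine RKHS.ext fun z => ?_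
    rw [h1, dbrInclusion_apply]
    exact congrFun hh z
  · intro h1
    refine ⟨dbrInclusion S f, funext fun z => dbrInclusion_apply S f z, funext fun z => ?_⟩
    rw [h1, dbrInclusion_apply]

lemma dbrInclusion_injective (S : SchurClass d U Y) : Function.Injective (dbrInclusion S) :=
  fun f g h => RKHS.ext fun z => by rw [← dbrInclusion_apply, h, dbrInclusion_apply]

end Inclusion

/-! ### Colligations -/

namespace Colligation

variable {d : ℕ} {X U Y V : Type*}
  [NormedAddCommGroup X] [InnerProductSpace ℂ X]
  [NormedAddCommGroup U] [InnerProductSpace ℂ U]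
  [NormedAddCommGroup Y] [InnerProductSpace ℂ Y]
  [NormedAddCommGroup V] [InnerProductSpace ℂ V]

lemma column_apply (T : Fin d → V →L[ℂ] X) (v : V) (j : Fin d) : column T v j = T j v := rfl

lemma row_apply (z : Ball d) (x : PiLp 2 (fun _ : Fin d => X)) :
    row X z x = ∑ j, z.1 j • x j := by
  simp [row]

lemma row_comp_column (A : Fin d → X →L[ℂ] X) (z : Ball d) :
    row X z ∘L column A = pencil A z.1 := by
  ext x
  simp [row_apply, column_apply, pencil_apply]

lemma connecting_apply (Γ : Colligation d X U Y) (x : X) (u : U) :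
    Γ.connecting (WithLp.toLp 2 (x, u)) =
      WithLp.toLp 2 (column Γ.A x + column Γ.B u, Γ.C x + Γ.D u) := rfl

variable [CompleteSpace X] [CompleteSpace Y]

lemma adjoint_row (z : Ball d) (x : X) :
    ContinuousLinearMap.adjoint (row X z) x = WithLp.toLp 2 fun j => conj (z.1 j) • x := by
  refine ext_inner_right ℂ fun v => ?_
  simp only [ContinuousLinearMap.adjoint_inner_left, PiLp.inner_apply, row_apply, inner_sum,
    inner_smul_left, inner_smul_right, RCLike.conj_conj]

lemma inner_adjoint_row (w z : Ball d) (x x' : X) :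
    ⟪ContinuousLinearMap.adjoint (row X w) x, ContinuousLinearMap.adjoint (row X z) x'⟫_ℂ =
      ⟪z.1, w.1⟫_ℂ * ⟪x, x'⟫_ℂ := by
  simp only [adjoint_row, PiLp.inner_apply, inner_smul_left, inner_smul_right, RCLike.conj_conj,
    Finset.sum_mul, RCLike.inner_apply]
  exact Finset.sum_congr rfl fun j _ => by ring

lemma adjoint_column_comp_adjoint_row (A : Fin d → X →L[ℂ] X) (w : Ball d) :
    ContinuousLinearMap.adjoint (column A) ∘L ContinuousLinearMap.adjoint (row X w) =
      pencil (fun j => ContinuousLinearMap.adjoint (A j)) (conjBall w).1 := by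
  rw [← ContinuousLinearMap.adjoint_comp, row_comp_column, adjoint_pencil]

/-- The operators `(I - A^* Z(w)^*)⁻¹ C^*`. -/
def resolventVector (Γ : Colligation d X U Y) (w : Ball d) : Y →L[ℂ] X :=
  Ring.inverse (1 - pencil (fun j => ContinuousLinearMap.adjoint (Γ.A j)) (conjBall w).1) ∘L
    ContinuousLinearMap.adjoint Γ.C

lemma weakDomain_eq (Γ : Colligation d X U Y) :
    Γ.weakDomain = (Submodule.span ℂ {x | ∃ (w : Ball d) (y : Y),
      x = ContinuousLinearMap.adjoint (row X w) (Γ.resolventVector w y)}).topologicalClosure := by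
  simp only [weakDomain, adjoint_column_comp_adjoint_row]
  rfl

lemma isUnit_one_sub_adjoint_pencil (A : Fin d → X →L[ℂ] X)
    (h : ∀ z : Ball d, IsUnit (1 - pencil A z.1)) (z : Ball d) :
    IsUnit (1 - pencil (fun j => ContinuousLinearMap.adjoint (A j)) z.1) := by
  have := (h (conjBall z)).star
  rwa [star_one_sub_pencil, conjBall_conjBall] at this

lemma adjoint_inverse_one_sub_pencil (A : Fin d → X →L[ℂ] X) (z : Ball d) :
    ContinuousLinearMap.adjoint (Ring.inverse (1 - pencil A z.1)) =
      Ring.inverse (1 - pencil (fun j => ContinuousLinearMap.adjoint (A j)) (conjBall z).1) := by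
  rw [← star_one_sub_pencil, Ring.inverse_star, ContinuousLinearMap.star_eq_adjoint]

lemma adjoint_resolventVector (Γ : Colligation d X U Y) (w : Ball d) :
    ContinuousLinearMap.adjoint (Γ.resolventVector w) =
      Γ.C ∘L Ring.inverse (1 - pencil Γ.A w.1) := by
  rw [resolventVector, ← adjoint_inverse_one_sub_pencil, ← ContinuousLinearMap.adjoint_comp,
    ContinuousLinearMap.adjoint_adjoint]

/-- The resolvent equation, read as the state component of the adjoint connecting operator at
`Z(w)^* F_w y ⊕ y`. -/
lemma one_sub_pencil_resolventVector (Γ : Colligation d X U Y)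
    (h : ∀ z : Ball d, IsUnit (1 - pencil Γ.A z.1)) (w : Ball d) (y : Y) :
    ContinuousLinearMap.adjoint (column Γ.A)
      (ContinuousLinearMap.adjoint (row X w) (Γ.resolventVector w y)) +
        ContinuousLinearMap.adjoint Γ.C y = Γ.resolventVector w y := by
  have h1 := isUnit_one_sub_adjoint_pencil Γ.A h (conjBall w)
  have h2 : (1 - pencil (fun j => ContinuousLinearMap.adjoint (Γ.A j)) (conjBall w).1)
      (Γ.resolventVector w y) = ContinuousLinearMap.adjoint Γ.C y := by
    rw [resolventVector, ContinuousLinearMap.comp_apply, ← mul_apply_eq_comp,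
      Ring.mul_inverse_cancel _ h1, one_apply_eq_self]
  rw [← h2, ← adjoint_column_comp_adjoint_row]
  simp

variable [CompleteSpace U]

lemma adjoint_connecting (Γ : Colligation d X U Y) (x : PiLp 2 (fun _ : Fin d => X)) (y : Y) :
    ContinuousLinearMap.adjoint Γ.connecting (WithLp.toLp 2 (x, y)) =
      WithLp.toLp 2
        (ContinuousLinearMap.adjoint (column Γ.A) x + ContinuousLinearMap.adjoint Γ.C y,
          ContinuousLinearMap.adjoint (column Γ.B) x + ContinuousLinearMap.adjoint Γ.D y) := by
  refine ext_inner_right ℂ fun v => ?_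
  obtain ⟨v, u⟩ := v
  rw [ContinuousLinearMap.adjoint_inner_left, connecting_apply]
  simp only [WithLp.prod_inner_apply, inner_add_left, inner_add_right,
    ContinuousLinearMap.adjoint_inner_left]
  ring

/-- The transfer function of a colligation in terms of the adjoints. -/
lemma realizes_iff (Γ : Colligation d X U Y) (S : Ball d → U →L[ℂ] Y) :
    Γ.Realizes S ↔ ∀ z : Ball d, IsUnit (1 - pencil Γ.A z.1) ∧
      ∀ y, ContinuousLinearMap.adjoint (S z) y = ContinuousLinearMap.adjoint (column Γ.B)
        (ContinuousLinearMap.adjoint (row X z) (Γ.resolventVector z y)) +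
          ContinuousLinearMap.adjoint Γ.D y := by
  refine forall_congr' fun z => ?_
  rw [row_comp_column]
  refine and_congr_right fun _ => ?_
  have h : Γ.D + Γ.C ∘L Ring.inverse (1 - pencil Γ.A z.1) ∘L row X z ∘L column Γ.B =
      ContinuousLinearMap.adjoint (ContinuousLinearMap.adjoint (column Γ.B) ∘L
        ContinuousLinearMap.adjoint (row X z) ∘L Γ.resolventVector z +
          ContinuousLinearMap.adjoint Γ.D) := by
    simp only [map_add, ContinuousLinearMap.adjoint_comp, ContinuousLinearMap.adjoint_adjoint,
      adjoint_resolventVector, add_comm, ContinuousLinearMap.comp_assoc]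
  rw [h, ← ContinuousLinearMap.adjoint.injective.eq_iff, ContinuousLinearMap.adjoint_adjoint,
    ContinuousLinearMap.ext_iff]
  rfl

/-- The adjoint of the connecting operator of a realization at the vectors `Z(w)^* F ⊕ y`. -/
lemma adjoint_connecting_resolventVector {Γ : Colligation d X U Y} {S : Ball d → U →L[ℂ] Y}
    (h : Γ.Realizes S) (w : Ball d) (y : Y) :
    ContinuousLinearMap.adjoint Γ.connecting
      (WithLp.toLp 2 (ContinuousLinearMap.adjoint (row X w) (Γ.resolventVector w y), y)) =
      WithLp.toLp 2 (Γ.resolventVector w y, ContinuousLinearMap.adjoint (S w) y) := by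
  have h' := (realizes_iff Γ S).mp h
  rw [adjoint_connecting, one_sub_pencil_resolventVector Γ fun z => (h' z).1, ← (h' w).2 y]

/-! ### Necessity -/

/-- Contractivity passes from the adjoint to the connecting operator, which is then applied to `x ⊕
0`. -/
lemma norm_sq_add_norm_sq_le (Γ : Colligation d X U Y)
    (h : ‖ContinuousLinearMap.adjoint Γ.connecting‖ ≤ 1) (x : X) :
    ∑ j, ‖Γ.A j x‖ ^ 2 + ‖Γ.C x‖ ^ 2 ≤ ‖x‖ ^ 2 := by
  rw [LinearIsometryEquiv.norm_map] at h
  have h1 := ContinuousLinearMap.le_of_opNorm_le _ h (WithLp.toLp 2 (x, (0 : U)))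
  rw [connecting_apply, one_mul] at h1
  have h2 := pow_le_pow_left₀ (norm_nonneg _) h1 2
  simpa [WithLp.prod_norm_sq_eq_of_L2, PiLp.norm_sq_eq_of_L2, column_apply] using h2

/-- Polarized isometry on the vectors `Z(w)^* F_w u ⊕ u` reads `⟨w, z⟩ G + ⟪u, v⟫ = G + ⟪S(w)^* u,
S(z)^* v⟫`, with `G` the Gram entry of the resolvent vectors. Solving for `G` gives the entry of
`K_S`. -/
lemma inner_resolventVector {Γ : Colligation d X U Y} {S : SchurClass d U Y}
    (h : Γ.IsCommWCRealization S.1) (w z : Ball d) (u v : Y) :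
    ⟪RKHS.kerFun (DBRSpace S) w u, RKHS.kerFun (DBRSpace S) z v⟫_ℂ =
      ⟪Γ.resolventVector w u, Γ.resolventVector z v⟫_ℂ := by
  have hmem : ∀ (w : Ball d) (y : Y),
      ContinuousLinearMap.adjoint (row X w) (Γ.resolventVector w y) ∈ Γ.weakDomain :=
    fun w y => by
      rw [weakDomain_eq]
      exact Submodule.le_topologicalClosure _ (Submodule.subset_span ⟨w, y, rfl⟩)
  -- The range of `E` is the subspace `weakDomain ⊕ Y` on which the adjoint is isometric.
  let E : Γ.weakDomain × Y →ₗ[ℂ] WithLp 2 (PiLp 2 (fun _ : Fin d => X) × Y) :=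
    (WithLp.linearEquiv 2 ℂ (PiLp 2 (fun _ : Fin d => X) × Y)).symm.toLinearMap ∘ₗ
      Γ.weakDomain.subtype.prodMap LinearMap.id
  let e : Ball d → Y → LinearMap.range E := fun w y =>
    ⟨WithLp.toLp 2 (ContinuousLinearMap.adjoint (row X w) (Γ.resolventVector w y), y),
      ⟨⟨_, hmem w y⟩, y⟩, rfl⟩
  have hE : ∀ x ∈ LinearMap.range E,
      ‖ContinuousLinearMap.adjoint Γ.connecting x‖ = ‖x‖ := by
    rintro _ ⟨⟨x, y⟩, rfl⟩
    exact h.weaklyCoisometric.2 x.1 x.2 y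
  have h1 := inner_map_map_of_norm_eq (ContinuousLinearMap.adjoint Γ.connecting)
    (LinearMap.range E) hE (e w u).2 (e z v).2
  simp only [e, adjoint_connecting_resolventVector h.realizes] at h1
  have h2 : ⟪(e w u).1, (e z v).1⟫_ℂ = ⟪z.1, w.1⟫_ℂ * ⟪Γ.resolventVector w u, Γ.resolventVector z v⟫_ℂ +
      ⟪u, v⟫_ℂ := by
    rw [← inner_adjoint_row]
    rfl
  have h1 := h1.trans h2
  rw [WithLp.prod_inner_apply] at h1
  simp only at h1
  have h3 := one_sub_inner_ne_zero w z
  rw [inner_kerFun_dbr, arvesonKernel, inv_mul_eq_iff_eq_mul₀ h3]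
  linear_combination -h1

/-- Necessity: a commutative weakly coisometric realization forces the invariance of the de
Branges-Rovnyak space under the backward shifts and the difference-quotient inequality. -/
theorem IsCommWCRealization.backwardShift {Γ : Colligation d X U Y} {S : SchurClass d U Y}
    (h : Γ.IsCommWCRealization S.1) :
    BackwardShiftInvariant (DBRSpace S) ∧ DifferenceQuotientInequality (DBRSpace S) := by
  have hu : ∀ z : Ball d, IsUnit (1 - pencil Γ.A z.1) :=
    fun z => ((realizes_iff Γ S.1).mp h.realizes z).1
  obtain ⟨V, hV, -, hVi⟩ := exists_contraction_of_inner_eq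
    (fun w => (RKHS.kerFun (DBRSpace S) w).toLinearMap) (fun w => (Γ.resolventVector w).toLinearMap)
    (inner_resolventVector h)
  have hV' : ∀ w y, V (RKHS.kerFun (DBRSpace S) w y) = Γ.resolventVector w y := hV
  have hVn : ∀ f, ‖V f‖ = ‖f‖ := fun f => hVi f (by
    rw [range_lsum_kerFun_dense]
    trivial)
  have hVV : ∀ f, ContinuousLinearMap.adjoint V (V f) = f := fun f => by
    have := (ContinuousLinearMap.norm_map_iff_adjoint_comp_self V).mp hVn
    exact congrArg (fun T : DBRSpace S →L[ℂ] DBRSpace S => T f) this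
  set L : Space d Y →L[ℂ] X := V ∘L ContinuousLinearMap.adjoint (dbrInclusion S) with hL
  have hLk : ∀ w y, L (RKHS.kerFun (Space d Y) w y) = Γ.resolventVector w y := fun w y => by
    rw [hL, ContinuousLinearMap.comp_apply, adjoint_dbrInclusion_kerFun, hV']
  have hLM : ∀ j, L ∘L shift Y j = ContinuousLinearMap.adjoint (Γ.A j) ∘L L := fun j => by
    refine ext_kerFun fun w y => ?_
    have := intertwines_of_intertwines_resolvent (shift Y)
      (fun j => ContinuousLinearMap.adjoint (Γ.A j)) shift_commute (fun i j => by
        have := congrArg ContinuousLinearMap.adjoint (h.commutative j i)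
        simpa only [ContinuousLinearMap.adjoint_comp, ContinuousLinearMap.mul_def] using this)
      isUnit_one_sub_pencil_shift (isUnit_one_sub_adjoint_pencil Γ.A hu) L
      (RKHS.kerFun (Space d Y) (origin d) y) (ContinuousLinearMap.adjoint Γ.C y) (fun z => by
        have := hLk (conjBall z) y
        rwa [← inverse_one_sub_pencil_shift, resolventVector, conjBall_conjBall] at this)
      (conjBall w) j
    rw [inverse_one_sub_pencil_shift] at this
    rw [ContinuousLinearMap.comp_apply, this, ContinuousLinearMap.comp_apply, hLk]
    rfl
  have hB : ∀ (j : Fin d) (f : DBRSpace S),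
      BackwardShiftEq j f (ContinuousLinearMap.adjoint V (Γ.A j (V f))) := fun j f => by
    rw [backwardShiftEq_iff]
    -- The adjoint of `L M_j = A_j^* L` is `M_j^* J V^* = J V^* A_j`; at `V f` the left side becomes
    -- `M_j^* J f`.
    have := congrArg (fun T => ContinuousLinearMap.adjoint T (V f)) (hLM j)
    simpa only [hL, ContinuousLinearMap.adjoint_comp, ContinuousLinearMap.adjoint_adjoint,
      ContinuousLinearMap.comp_apply, hVV] using this
  refine ⟨fun j f => ⟨_, hB j f⟩, fun f g hg => ?_⟩
  -- The inequality concerns any backward shifts `g j` of `f`; injectivity of the inclusion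
  -- identifies them with those found above.
  have hg' : ∀ j, g j = ContinuousLinearMap.adjoint V (Γ.A j (V f)) := fun j =>
    dbrInclusion_injective S (((backwardShiftEq_iff S j f _).mp (hg j)).symm.trans
      ((backwardShiftEq_iff S j f _).mp (hB j f)))
  have h0 : f (origin d) = Γ.C (V f) := by
    refine ext_inner_left ℂ fun y => ?_
    have h1 : Γ.resolventVector (origin d) y = ContinuousLinearMap.adjoint Γ.C y := by
      have h2 : pencil (fun j => ContinuousLinearMap.adjoint (Γ.A j)) (conjBall (origin d)).1 =
          0 := by
        simp [pencil, origin]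
      simp [resolventVector, h2]
    rw [← ContinuousLinearMap.adjoint_inner_left, ← h1, ← hV',
      ← ContinuousLinearMap.adjoint_inner_right, hVV, RKHS.kerFun_inner]
  have hVa : ∀ x, ‖ContinuousLinearMap.adjoint V x‖ ≤ ‖x‖ := fun x => by
    refine (ContinuousLinearMap.le_of_opNorm_le _ (c := 1) ?_ x).trans (one_mul _).le
    rw [LinearIsometryEquiv.norm_map]
    exact ContinuousLinearMap.opNorm_le_bound _ zero_le_one fun f => by rw [hVn, one_mul]
  have h3 := norm_sq_add_norm_sq_le Γ h.weaklyCoisometric.1 (V f)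
  rw [hVn, ← h0] at h3
  refine le_trans (Finset.sum_le_sum fun j _ => ?_) (le_sub_iff_add_le.mpr h3)
  rw [hg' j]
  exact pow_le_pow_left₀ (norm_nonneg _) (hVa _) 2

end Colligation

/-! ### Sufficiency: the functional model -/

/-- A defect operator of a contraction. -/
lemma exists_defect {E H : Type*} [NormedAddCommGroup E] [InnerProductSpace ℂ E] [CompleteSpace E]
    [NormedAddCommGroup H] [InnerProductSpace ℂ H] [CompleteSpace H] (T : E →L[ℂ] H)
    (hT : ∀ x, ‖T x‖ ≤ ‖x‖) :
    ∃ Q : E →L[ℂ] E, ∀ x y, ⟪Q x, Q y⟫_ℂ = ⟪x, y⟫_ℂ - ⟪T x, T y⟫_ℂ := by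
  have h : (0 : E →L[ℂ] E) ≤ 1 - ContinuousLinearMap.adjoint T ∘L T := by
    rw [ContinuousLinearMap.nonneg_iff_isPositive, ContinuousLinearMap.isPositive_def']
    refine ⟨?_, fun x => ?_⟩
    · rw [isSelfAdjoint_iff, star_sub, star_one, ContinuousLinearMap.star_eq_adjoint,
        ContinuousLinearMap.adjoint_comp, ContinuousLinearMap.adjoint_adjoint]
    · rw [ContinuousLinearMap.reApplyInnerSelf_apply, _root_.sub_apply, inner_sub_left,
        one_apply_eq_self, ContinuousLinearMap.comp_apply,
        ContinuousLinearMap.adjoint_inner_left, map_sub, inner_self_eq_norm_sq,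
        inner_self_eq_norm_sq]
      exact sub_nonneg.mpr (pow_le_pow_left₀ (norm_nonneg _) (hT x) 2)
  -- Any factor with `Q^* Q = 1 - T^* T` serves; positivity of `Q` plays no role.
  obtain ⟨Q, hQ⟩ := CStarAlgebra.nonneg_iff_eq_star_mul_self.mp h
  refine ⟨Q, fun x y => ?_⟩
  have h1 : ⟪x, (star Q * Q) y⟫_ℂ = ⟪Q x, Q y⟫_ℂ := by
    rw [mul_apply_eq_comp, ContinuousLinearMap.star_eq_adjoint,
      ContinuousLinearMap.adjoint_inner_right]
  rw [← h1, ← hQ, _root_.sub_apply, inner_sub_right, one_apply_eq_self,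
    ContinuousLinearMap.comp_apply, ContinuousLinearMap.adjoint_inner_right]

/-- Completion of a contraction `T` to a contractive column `x ↦ (T x, R x)` that takes prescribed
values on a family of vectors and is isometric on its closed span. -/
theorem exists_contractive_completion {ι Y E H U : Type*} [NormedAddCommGroup Y]
    [InnerProductSpace ℂ Y] [NormedAddCommGroup E] [InnerProductSpace ℂ E] [CompleteSpace E]
    [NormedAddCommGroup H] [InnerProductSpace ℂ H] [CompleteSpace H]
    [NormedAddCommGroup U] [InnerProductSpace ℂ U] [CompleteSpace U] (T : E →L[ℂ] H)
    (hT : ∀ x, ‖T x‖ ≤ ‖x‖) (e : ι → Y →L[ℂ] E) (s : ι → Y →L[ℂ] U)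
    (h : ∀ i j u v, ⟪e i u, e j v⟫_ℂ = ⟪T (e i u), T (e j v)⟫_ℂ + ⟪s i u, s j v⟫_ℂ) :
    ∃ R : E →L[ℂ] U, (∀ i u, R (e i u) = s i u) ∧ (∀ x, ‖T x‖ ^ 2 + ‖R x‖ ^ 2 ≤ ‖x‖ ^ 2) ∧
      ∃ P : Submodule ℂ E, IsClosed (P : Set E) ∧ (∀ i u, e i u ∈ P) ∧
        ∀ x ∈ P, ‖T x‖ ^ 2 + ‖R x‖ ^ 2 = ‖x‖ ^ 2 := by
  obtain ⟨Q, hQ⟩ := exists_defect T hT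
  -- By `h` and the defect identity, the vectors `Q (e i u)` and `s i u` have equal Gram matrices.
  obtain ⟨V, hV, hVn, hVi⟩ := exists_contraction_of_inner_eq
    (fun i => (Q ∘L e i).toLinearMap) (fun i => (s i).toLinearMap) (fun i j u v => by
      simp only [ContinuousLinearMap.coe_coe, ContinuousLinearMap.comp_apply, hQ, h]
      ring)
  have hQn : ∀ x, ‖T x‖ ^ 2 + ‖Q x‖ ^ 2 = ‖x‖ ^ 2 := fun x => by
    have h1 := congrArg (RCLike.re (K := ℂ)) (hQ x x)
    rw [map_sub, inner_self_eq_norm_sq, inner_self_eq_norm_sq, inner_self_eq_norm_sq] at h1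
    linarith
  -- Since `‖T x‖² + ‖Q x‖² = ‖x‖²`, equality holds for `R = V Q` wherever `V` is isometric at `Q
  -- x`. Thus `P` is the preimage under `Q` of the closed span.
  refine ⟨V ∘L Q, hV, fun x => ?_, (LinearMap.range (Finsupp.lsum ℂ fun i =>
    (Q ∘L e i).toLinearMap)).topologicalClosure.comap Q.toLinearMap,
    (Submodule.isClosed_topologicalClosure _).preimage Q.continuous, fun i u => ?_,
    fun x hx => ?_⟩
  · rw [← hQn x]
    exact add_le_add_right (pow_le_pow_left₀ (norm_nonneg _) (hVn _) 2) _
  · exact Submodule.le_topologicalClosure _ ⟨Finsupp.single i u, by simp⟩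
  · rw [← hQn x, ContinuousLinearMap.comp_apply]
    exact congrArg (fun r : ℝ => ‖T x‖ ^ 2 + r ^ 2) (hVi _ hx)

section Model

variable {d : ℕ} {U Y : Type*} [NormedAddCommGroup U] [InnerProductSpace ℂ U] [CompleteSpace U]
  [NormedAddCommGroup Y] [InnerProductSpace ℂ Y] [CompleteSpace Y]

/-- The restricted backward shifts on a de Branges-Rovnyak space. -/
lemma exists_restricted_backwardShift (S : SchurClass d U Y)
    (hI : BackwardShiftInvariant (DBRSpace S)) (hQ : DifferenceQuotientInequality (DBRSpace S)) :
    ∃ A : Fin d → DBRSpace S →L[ℂ] DBRSpace S, ∀ j f, BackwardShiftEq j f (A j f) := by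
  choose a ha using hI
  have ha' := fun j f => (backwardShiftEq_iff S j f (a j f)).mp (ha j f)
  -- A single term of the difference-quotient inequality bounds each restricted shift by 1.
  have hn : ∀ j f, ‖a j f‖ ≤ 1 * ‖f‖ := fun j f => by
    have h1 := hQ f (fun j => a j f) fun j => ha j f
    have h2 := Finset.single_le_sum (f := fun i => ‖a i f‖ ^ 2) (fun i _ => by positivity)
      (Finset.mem_univ j)
    refine le_of_sq_le_sq ?_ (by positivity)
    nlinarith [sq_nonneg ‖f (origin d)‖]
  refine ⟨fun j => LinearMap.mkContinuous
    { toFun := a j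
      map_add' := fun f g => dbrInclusion_injective S (by simp only [map_add, ← ha'])
      map_smul' := fun c f => dbrInclusion_injective S (by
        simp only [map_smul, ← ha', RingHom.id_apply]) } 1 (hn j), fun j f => ha j f⟩

namespace Colligation

/-- The embedding `x ↦ x ⊕ 0` of `X^d` into `X^d ⊕ Y`. -/
def stateInl (d : ℕ) (X Y : Type*) [NormedAddCommGroup X] [InnerProductSpace ℂ X]
    [NormedAddCommGroup Y] [InnerProductSpace ℂ Y] :
    PiLp 2 (fun _ : Fin d => X) →L[ℂ] WithLp 2 (PiLp 2 (fun _ : Fin d => X) × Y) :=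
  (WithLp.prodContinuousLinearEquiv 2 ℂ (PiLp 2 (fun _ : Fin d => X)) Y).symm.toContinuousLinearMap
    ∘L ContinuousLinearMap.inl ℂ _ _

/-- The vectors `Z(w)^* K(·, w) y ⊕ y` of the functional model. -/
def modelVector (S : SchurClass d U Y) (w : Ball d) :
    Y →L[ℂ] WithLp 2 (PiLp 2 (fun _ : Fin d => DBRSpace S) × Y) :=
  (WithLp.prodContinuousLinearEquiv 2 ℂ
    (PiLp 2 (fun _ : Fin d => DBRSpace S)) Y).symm.toContinuousLinearMap ∘L
      (ContinuousLinearMap.adjoint (row (DBRSpace S) w) ∘L RKHS.kerFun (DBRSpace S) w).prod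
        (ContinuousLinearMap.id ℂ Y)

lemma modelVector_apply (S : SchurClass d U Y) (w : Ball d) (y : Y) :
    modelVector S w y = WithLp.toLp 2 (ContinuousLinearMap.adjoint (row (DBRSpace S) w)
      (RKHS.kerFun (DBRSpace S) w y), y) := rfl

/-- As `Z(0) = 0`, the model vectors include all of `0 ⊕ Y`. This forces `D = S(0)` and lets the two
summands be treated separately. -/
lemma modelVector_origin (S : SchurClass d U Y) (y : Y) :
    modelVector S (origin d) y = WithLp.toLp 2 (0, y) := by
  rw [modelVector_apply, adjoint_row]
  congr 2
  exact PiLp.ext fun j => by simp [origin]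

/-- The definition of `K_S` rearranged as `⟨w, z⟩ K + I = K + S S^*`: the Gram condition required by
the completion. -/
lemma inner_modelVector (S : SchurClass d U Y) (w z : Ball d) (u v : Y) :
    ⟪modelVector S w u, modelVector S z v⟫_ℂ =
      ⟪RKHS.kerFun (DBRSpace S) w u, RKHS.kerFun (DBRSpace S) z v⟫_ℂ +
        ⟪ContinuousLinearMap.adjoint (S.1 w) u, ContinuousLinearMap.adjoint (S.1 z) v⟫_ℂ := by
  have h := one_sub_inner_ne_zero w z
  rw [modelVector_apply, modelVector_apply, WithLp.prod_inner_apply]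
  simp only [inner_adjoint_row]
  rw [inner_kerFun_dbr, arvesonKernel]
  field_simp
  ring

/-- For a colligation with the functional-model state and output operators, the resolvent vectors
are the kernel functions of the de Branges-Rovnyak space. -/
lemma resolventVector_model {S : SchurClass d U Y} (Γ : Colligation d (DBRSpace S) U Y)
    (hA : ∀ j f, BackwardShiftEq j f (Γ.A j f))
    (hC : Γ.C = ContinuousLinearMap.adjoint (RKHS.kerFun (DBRSpace S) (origin d)))
    (hu : ∀ z : Ball d, IsUnit (1 - pencil Γ.A z.1)) (w : Ball d) :
    Γ.resolventVector w = RKHS.kerFun (DBRSpace S) w := by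
  ext1 y
  -- Dual form of `f(w) - ∑ j, w_j (A_j f)(w) = f(0)`.
  have h : (1 - pencil (fun j => ContinuousLinearMap.adjoint (Γ.A j)) (conjBall w).1)
      (RKHS.kerFun (DBRSpace S) w y) = RKHS.kerFun (DBRSpace S) (origin d) y := by
    refine ext_inner_right ℂ fun f => ?_
    have h1 := apply_eq_add_sum_adjoint_shift (dbrInclusion S f) w
    simp only [fun j => (backwardShiftEq_iff S j f _).mp (hA j f), dbrInclusion_apply] at h1
    rw [← star_one_sub_pencil, ContinuousLinearMap.star_eq_adjoint,
      ContinuousLinearMap.adjoint_inner_left, RKHS.kerFun_inner, RKHS.kerFun_inner,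
      _root_.sub_apply, one_apply_eq_self, RKHS.coe_sub, Pi.sub_apply, pencil_apply,
      coe_sum_apply]
    simp only [RKHS.coe_smul, Pi.smul_apply]
    rw [h1, add_sub_cancel_right]
  rw [resolventVector, hC, ContinuousLinearMap.adjoint_adjoint, ContinuousLinearMap.comp_apply,
    ← h, ← mul_apply_eq_comp, Ring.inverse_mul_cancel _ (isUnit_one_sub_adjoint_pencil Γ.A hu _),
    one_apply_eq_self]

/-- The column `x ↦ A x ⊕ C x` of the state and output operators. -/
def outputColumn {X : Type*} [NormedAddCommGroup X] [InnerProductSpace ℂ X]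
    (A : Fin d → X →L[ℂ] X) (C : X →L[ℂ] Y) :
    X →L[ℂ] WithLp 2 (PiLp 2 (fun _ : Fin d => X) × Y) :=
  (WithLp.prodContinuousLinearEquiv 2 ℂ (PiLp 2 (fun _ : Fin d => X)) Y).symm.toContinuousLinearMap
    ∘L (column A).prod C

section OutputColumn

variable {X : Type*} [NormedAddCommGroup X] [InnerProductSpace ℂ X] [CompleteSpace X]

lemma adjoint_outputColumn_apply (A : Fin d → X →L[ℂ] X) (C : X →L[ℂ] Y)
    (x : PiLp 2 (fun _ : Fin d => X)) (y : Y) :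
    ContinuousLinearMap.adjoint (outputColumn A C) (WithLp.toLp 2 (x, y)) =
      ContinuousLinearMap.adjoint (column A) x + ContinuousLinearMap.adjoint C y := by
  refine ext_inner_right ℂ fun f => ?_
  have h1 : outputColumn A C f = WithLp.toLp 2 (column A f, C f) := rfl
  rw [ContinuousLinearMap.adjoint_inner_left, h1, WithLp.prod_inner_apply,
    inner_add_left, ContinuousLinearMap.adjoint_inner_left,
    ContinuousLinearMap.adjoint_inner_left]

lemma norm_adjoint_outputColumn_le (A : Fin d → X →L[ℂ] X) (C : X →L[ℂ] Y)
    (h : ∀ f, ∑ j, ‖A j f‖ ^ 2 + ‖C f‖ ^ 2 ≤ ‖f‖ ^ 2)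
    (x : WithLp 2 (PiLp 2 (fun _ : Fin d => X) × Y)) :
    ‖ContinuousLinearMap.adjoint (outputColumn A C) x‖ ≤ ‖x‖ := by
  refine (ContinuousLinearMap.le_of_opNorm_le _ (c := 1) ?_ x).trans (one_mul _).le
  rw [LinearIsometryEquiv.norm_map]
  refine ContinuousLinearMap.opNorm_le_bound _ zero_le_one fun f => ?_
  rw [one_mul]
  refine le_of_sq_le_sq ?_ (norm_nonneg _)
  have h1 : outputColumn A C f = WithLp.toLp 2 (column A f, C f) := rfl
  rw [h1, WithLp.prod_norm_sq_eq_of_L2, PiLp.norm_sq_eq_of_L2]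
  exact h f

end OutputColumn

lemma adjoint_outputColumn_modelVector (S : SchurClass d U Y)
    (A : Fin d → DBRSpace S →L[ℂ] DBRSpace S) (hA : ∀ j f, BackwardShiftEq j f (A j f))
    (hu : ∀ z : Ball d, IsUnit (1 - pencil A z.1)) (w : Ball d) (y : Y) :
    ContinuousLinearMap.adjoint (outputColumn A
        (ContinuousLinearMap.adjoint (RKHS.kerFun (DBRSpace S) (origin d)))) (modelVector S w y) =
      RKHS.kerFun (DBRSpace S) w y := by
  -- Resolvent vectors do not involve `B` and `D`, so zero blocks suffice here.
  let Γ : Colligation d (DBRSpace S) U Y :=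
    ⟨A, 0, ContinuousLinearMap.adjoint (RKHS.kerFun (DBRSpace S) (origin d)), 0⟩
  have h := one_sub_pencil_resolventVector Γ hu w y
  rw [resolventVector_model Γ hA rfl hu] at h
  rw [modelVector_apply, adjoint_outputColumn_apply]
  exact h

/-- Sufficiency: the functional-model realization. -/
theorem exists_functionalModel (S : SchurClass d U Y)
    (hI : BackwardShiftInvariant (DBRSpace S)) (hQ : DifferenceQuotientInequality (DBRSpace S)) :
    ∃ Γ : Colligation d (DBRSpace S) U Y, IsFunctionalModel S Γ := by
  obtain ⟨A, hA⟩ := exists_restricted_backwardShift S hI hQ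
  have hA' := fun j f => (backwardShiftEq_iff S j f (A j f)).mp (hA j f)
  set C : DBRSpace S →L[ℂ] Y :=
    ContinuousLinearMap.adjoint (RKHS.kerFun (DBRSpace S) (origin d)) with hC
  have hACn : ∀ f, ∑ j, ‖A j f‖ ^ 2 + ‖C f‖ ^ 2 ≤ ‖f‖ ^ 2 := fun f => by
    have := hQ f (fun j => A j f) fun j => hA j f
    rw [hC, RKHS.adjoint_kerFun]
    linarith
  have hu : ∀ z : Ball d, IsUnit (1 - pencil A z.1) := isUnit_one_sub_pencil A fun f =>
    le_trans (le_add_of_nonneg_right (sq_nonneg _)) (hACn f)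
  set T := ContinuousLinearMap.adjoint (outputColumn A C) with hTdef
  have hT : ∀ x, ‖T x‖ ≤ ‖x‖ := norm_adjoint_outputColumn_le A C hACn
  have hTa := adjoint_outputColumn_apply A C
  have hTe := adjoint_outputColumn_modelVector S A hA hu
  obtain ⟨R, hRe, hRn, P, hPc, hPm, hPi⟩ := exists_contractive_completion T hT (modelVector S)
    (fun w => ContinuousLinearMap.adjoint (S.1 w)) (fun w z u v => by
      rw [hTe, hTe]
      exact inner_modelVector S w z u v)
  -- The input column is chosen so that `B^*` is the restriction of `R` to `X^d ⊕ 0`. On `0 ⊕ Y`,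
  -- `R` already equals `S(0)^*`, so `R` is the whole input component of the adjoint.
  let β := ContinuousLinearMap.adjoint (R ∘L stateInl d (DBRSpace S) Y)
  let Γ : Colligation d (DBRSpace S) U Y :=
    ⟨A, fun j => PiLp.proj 2 (fun _ : Fin d => DBRSpace S) j ∘L β, C, S.1 (origin d)⟩
  have hB : ∀ x, ContinuousLinearMap.adjoint (column Γ.B) x = R (WithLp.toLp 2 (x, 0)) := fun x => by
    have h1 : column Γ.B = β := rfl
    rw [h1, ContinuousLinearMap.adjoint_adjoint]
    rfl
  have hadd : ∀ (x : PiLp 2 (fun _ : Fin d => DBRSpace S)) (y : Y),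
      WithLp.toLp 2 (x, y) = WithLp.toLp 2 (x, 0) + modelVector S (origin d) y := fun x y => by
    rw [modelVector_origin, ← WithLp.toLp_add]
    simp
  have hD : ∀ x y, ContinuousLinearMap.adjoint (column Γ.B) x +
      ContinuousLinearMap.adjoint Γ.D y = R (WithLp.toLp 2 (x, y)) := fun x y => by
    rw [hB, hadd x y, map_add, hRe]
  have hconn : ∀ x y, ContinuousLinearMap.adjoint Γ.connecting (WithLp.toLp 2 (x, y)) =
      WithLp.toLp 2 (T (WithLp.toLp 2 (x, y)), R (WithLp.toLp 2 (x, y))) := fun x y => by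
    rw [adjoint_connecting, hD, hTa]
  refine ⟨Γ, hA, RKHS.adjoint_kerFun (origin d), rfl, ?_, ?_, ?_, ?_⟩
  · refine (realizes_iff Γ S.1).mpr fun z => ⟨hu z, fun y => ?_⟩
    rw [resolventVector_model Γ hA hC hu, hD, ← hRe, modelVector_apply]
  -- Commutativity is inherited from the adjoint shifts through the injective inclusion.
  · refine fun i j => ContinuousLinearMap.ext fun f => dbrInclusion_injective S ?_
    have h1 := congrArg (fun T => ContinuousLinearMap.adjoint T (dbrInclusion S f))
      (shift_commute (Y := Y) j i)
    simpa only [ContinuousLinearMap.mul_def, ContinuousLinearMap.adjoint_comp,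
      ContinuousLinearMap.comp_apply, hA'] using h1
  · refine ContinuousLinearMap.opNorm_le_bound _ zero_le_one fun e => ?_
    obtain ⟨x, y⟩ := e
    rw [hconn, one_mul]
    refine le_of_sq_le_sq ?_ (norm_nonneg _)
    rw [WithLp.prod_norm_sq_eq_of_L2]
    exact hRn _
  · intro x hx y
    have hmem : Γ.weakDomain ≤
        P.comap (stateInl d (DBRSpace S) Y).toLinearMap := by
      rw [weakDomain_eq]
      refine Submodule.topologicalClosure_minimal _ (Submodule.span_le.mpr ?_)
        (hPc.preimage (stateInl d (DBRSpace S) Y).continuous)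
      rintro _ ⟨w, y, rfl⟩
      rw [resolventVector_model Γ hA hC hu]
      -- Subtracting the model vector at the origin removes the `Y` component, so each generator of
      -- `weakDomain` lies in `P`; closedness of `P` handles the closure.
      have h1 : stateInl d (DBRSpace S) Y (ContinuousLinearMap.adjoint (row (DBRSpace S) w)
          (RKHS.kerFun (DBRSpace S) w y)) = modelVector S w y - modelVector S (origin d) y :=
        eq_sub_of_add_eq (hadd _ y).symm
      change stateInl d (DBRSpace S) Y _ ∈ P
      rw [h1]
      exact P.sub_mem (hPm w y) (hPm _ y)
    have hxy : WithLp.toLp 2 (x, y) ∈ P := by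
      rw [hadd x y]
      exact P.add_mem (hmem hx) (hPm _ y)
    rw [hconn]
    refine (sq_eq_sq₀ (norm_nonneg _) (norm_nonneg _)).mp ?_
    rw [WithLp.prod_norm_sq_eq_of_L2]
    exact hPi _ hxy

end Colligation

end Model

end DruryArveson

end

theorem theoremT (d : ℕ)
    (U : Type u) [NormedAddCommGroup U] [InnerProductSpace ℂ U] [CompleteSpace U]
    (Y : Type v) [NormedAddCommGroup Y] [InnerProductSpace ℂ Y] [CompleteSpace Y]
    (S : DruryArveson.SchurClass d U Y) :
    -- the equivalence
    (DruryArveson.HasCommWCRealization.{v} S.1 ↔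
      DruryArveson.BackwardShiftInvariant (DruryArveson.DBRSpace S) ∧
        DruryArveson.DifferenceQuotientInequality (DruryArveson.DBRSpace S)) ∧
    -- necessity, for state spaces in an arbitrary universe
    (DruryArveson.HasCommWCRealization.{w} S.1 →
      DruryArveson.BackwardShiftInvariant (DruryArveson.DBRSpace S) ∧
        DruryArveson.DifferenceQuotientInequality (DruryArveson.DBRSpace S)) ∧
    -- existence of a functional-model realization
    (DruryArveson.BackwardShiftInvariant (DruryArveson.DBRSpace S) ∧
        DruryArveson.DifferenceQuotientInequality (DruryArveson.DBRSpace S) →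
      ∃ Γ : DruryArveson.Colligation d (DruryArveson.DBRSpace S) U Y,
        DruryArveson.IsFunctionalModel S Γ) := by
  have hs : DruryArveson.BackwardShiftInvariant (DruryArveson.DBRSpace S) ∧
      DruryArveson.DifferenceQuotientInequality (DruryArveson.DBRSpace S) →
      ∃ Γ : DruryArveson.Colligation d (DruryArveson.DBRSpace S) U Y,
        DruryArveson.IsFunctionalModel S Γ :=
    fun h => DruryArveson.Colligation.exists_functionalModel S h.1 h.2
  refine ⟨⟨?_, fun h => ?_⟩, ?_, hs⟩
  · rintro ⟨X, _, _, _, Γ, hΓ⟩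
    exact hΓ.backwardShift
  · obtain ⟨Γ, hΓ⟩ := hs h
    -- The model space lies in the universe of `Y`, which is why the equivalence takes its state
    -- spaces there.
    exact ⟨DruryArveson.DBRSpace S, inferInstance, inferInstance, inferInstance, Γ, hΓ.realization⟩
  · rintro ⟨X, _, _, _, Γ, hΓ⟩
    exact hΓ.backwardShift
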